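/- There is a universal constant $K>0$ with the following property. Let $T$ be a finite set and let $\nu\neq 0$ be a $\sigma$-finite Borel measure on $\mathbb{R}^T$ without atoms (every point has $\nu$-measure $0$; in particular $\nu(\{0\})=0$) such that $\int_{\mathbb{R}^T}\min(|x(t)|,1)\,d\nu(x)<\infty$ for every $t\in T$. Let $(Y_i)$ be a Poisson point process on $\mathbb{R}^T$ with intensity measure $\nu$, that is, a finite or infinite random sequence of points such that for every Borel set $A$ the number of indices $i$ with $Y_i\in A$ is Poisson distributed with parameter $\nu(A)$ (almost surely infinite if $\nu(A)=\infty$), and such that these numbers are independent for pairwise disjoint sets. For a measurable $f:\mathbb{R}^T\to\mathbb{R}$ put $|X|_f=\sum_i |f(Y_i)|\in[0,\infty]$, and for $t\in T$ put $|X|_t=\sum_i|Y_i(t)|$. Then there exists a countable family $\mathcal{F}$ of pairs $(g,u)$, where $g:\mathbb{R}^T\to[0,\infty)$ is measurable and $u\in[0,\infty)$, such that $$\Big\{\sup_{t\in T}|X|_t\ \ge\ K\,\mathbf{E}\sup_{t\in T}|X|_t\Big\}\ \subseteq\ \bigcup_{(g,u)\in\mathcal{F}}\{|X|_g\ge u\}$$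 and $$\sum_{(g,u)\in\mathcal{F}}\mathbf{P}(|X|_g\ge u)\ \le\ \frac12 .$$ (The expectation may be $+\infty$, in which case $K\cdot\infty=\infty$.) -/

import Mathlib

open MeasureTheory ProbabilityTheory
open scoped NNReal ENNReal

noncomputable section

/-- For a random sequence of points `Y 0, Y 1, …` of which only those with index `i < κ` are present
(`κ` is the possibly infinite random total number of points), the number of present points
lying in `A`, counted with multiplicity. -/
def pointCount {Ω E : Type*} (κ : Ω → ℕ∞) (Y : ℕ → Ω → E) (A : Set E) (ω : Ω) : ℕ∞ :=
  Set.encard {i : ℕ | (i : ℕ∞) < κ ω ∧ Y i ω ∈ A}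

/-- The random points `Y i`, `i < κ`, form a Poisson point process with intensity measure `ν`:
the number of points in `A` is Poisson with parameter `ν A` (almost surely infinite if
`ν A = ∞`), and the numbers of points in disjoint sets are independent. -/
structure IsPoissonPointProcess {Ω E : Type*} [MeasurableSpace Ω] [MeasurableSpace E]
    (κ : Ω → ℕ∞) (Y : ℕ → Ω → E) (ν : Measure E) (P : Measure Ω) : Prop where
  measurable_total : Measurable κ
  measurable_point : ∀ i, Measurable (Y i)
  poisson_law : ∀ A : Set E, MeasurableSet A → ν A ≠ ∞ →
    ∀ n : ℕ, P {ω | pointCount κ Y A ω = n} = poissonMeasure (ν A).toNNReal {n}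
  infinite_law : ∀ A : Set E, MeasurableSet A → ν A = ∞ →
    ∀ᵐ ω ∂P, pointCount κ Y A ω = ⊤
  indep : ∀ (m : ℕ) (A : Fin m → Set E), (∀ k, MeasurableSet (A k)) →
    Pairwise (fun k l => Disjoint (A k) (A l)) →
    iIndepFun (fun k => pointCount κ Y (A k)) P

/-- `|X|_f = ∑ |f (Y i)|`, the sum running over the present points; it takes values
in `[0, ∞]`. -/
def absSum {Ω E : Type*} (κ : Ω → ℕ∞) (Y : ℕ → Ω → E) (f : E → ℝ) (ω : Ω) : ℝ≥0∞ :=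
  ∑' i : {i : ℕ // (i : ℕ∞) < κ ω}, ENNReal.ofReal |f (Y i ω)|

/-- `sup_{t ∈ T} |X|_t`, where `t ∈ T` is identified with the coordinate function `x ↦ x t`
on `ℝ^T`. -/
def supProcess {Ω T : Type*} (κ : Ω → ℕ∞) (Y : ℕ → Ω → (T → ℝ)) (ω : Ω) : ℝ≥0∞ :=
  ⨆ t : T, absSum κ Y (fun x => x t) ω

end

/-! Occupation of a whole family of disjoint cells is itself contained in a half-space event: weight
each cell Q by log(1/ν(Q)) and ask that the weighted number of points reach the sum of the weights.
A Poisson variable N of mean a satisfies E a^(-N) ≤ e, so Chernoff bounds the probability of this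
half-space by the product of the numbers e·ν(Q) (`measure_log_le_absSum`). It remains to force,
whenever the supremum is large, one of a cheap collection of cell families to be occupied.

Since ν has no atoms, the functions |x t| are approximated from below by functions constant on
finitely many small cells (`exists_cells`). Campbell's formula with Markov's inequality controls the
remainders, and smallness of the cells controls double points. What is left is a positive selector
process: the supremum over t of the sum of λ_t(i) over the random set W of occupied cells, which are
occupied independently with probabilities p_i = 1 - exp(-ν(Q_i)).

Such processes are treated by the argument of Park and Pham (`exists_selector_cover`). Raise p to q
= Kp; the mean E of the supremum grows at most by the factor K. Let W be a set on which the supremum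
is below 2KE. A set S with λ_t(S) ≥ 4KE, listed by decreasing λ_t, must have an initial segment less
than half of which lies in W. A minimal choice then yields a fragment T of S outside W which, for
some t < 2|T|, is one of at most 2^t subsets determined by W ∪ T. Passing from W to W ∪ T gains a
small factor for each element of T, which beats 2^t. Thus fragments are cheap on average over W, and
a good W supplies the cover.

An infinite mean is handled separately, by truncating the coordinates at 1
(`hasHalfSpaceCover_supProcess_eq_top`). -/

noncomputable section

/-! ### Positive selector processes and the Park–Pham cover. -/

section Combinatorics

open Finset

section Lists

variable {ι : Type*} [DecidableEq ι]

/-- Linearity of expectation: each element of `W` escapes the random discarded set `D` with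
probability `r`. -/
lemma sum_powerset_binomial_weight_linear (r : ℝ) (a : ι → ℝ) (W : Finset ι) :
    ∑ D ∈ W.powerset, r ^ (W \ D).card * (1 - r) ^ D.card * ∑ i ∈ W \ D, a i =
      r * ∑ i ∈ W, a i := by
  have h1 : ∀ D ∈ W.powerset, r ^ (W \ D).card * (1 - r) ^ D.card * ∑ i ∈ W \ D, a i =
      ∑ i ∈ W, if i ∉ D then r ^ (W \ D).card * (1 - r) ^ D.card * a i else 0 := by
    intro D _
    rw [Finset.mul_sum, ← Finset.sum_filter]
    refine Finset.sum_congr ?_ fun _ _ => rfl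
    ext i; simp
  rw [Finset.sum_congr rfl h1, Finset.sum_comm, Finset.mul_sum]
  refine Finset.sum_congr rfl fun i hi => ?_
  rw [← Finset.sum_filter]
  have h2 : {D ∈ W.powerset | i ∉ D} = (W.erase i).powerset := by
    ext D
    simp only [mem_filter, mem_powerset, Finset.subset_erase]
  rw [h2]
  have h3 : ∀ D ∈ (W.erase i).powerset, r ^ (W \ D).card * (1 - r) ^ D.card * a i =
      r * a i * ((1 - r) ^ D.card * r ^ ((W.erase i).card - D.card)) := by
    intro D hD
    have hD' := mem_powerset.1 hD
    have : (W \ D).card = ((W.erase i).card - D.card) + 1 := by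
      have e1 := card_sdiff_of_subset (hD'.trans (erase_subset i W))
      have e2 := card_erase_add_one hi
      have e3 := card_le_card hD'
      omega
    rw [this]; ring
  rw [Finset.sum_congr rfl h3, ← Finset.mul_sum, Finset.sum_pow_mul_eq_add_pow]
  simp

/-- Abel summation, by induction on the last entry. The lower bound `x` strengthens the induction:
the hypothesis is applied with `x` equal to the value of `a` at the new, smallest entry. -/
lemma sum_map_mul_ge_of_partial_sums_nonneg {α : Type*} (a c : α → ℝ) (l : List α) :
    l.Pairwise (fun i j => a j ≤ a i) → (∀ i ∈ l, 0 ≤ a i) →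
    (∀ s ≤ l.length, 0 ≤ ((l.take s).map c).sum) →
    ∀ x : ℝ, (∀ i ∈ l, x ≤ a i) → x * (l.map c).sum ≤ (l.map fun i => a i * c i).sum := by
  induction l using List.reverseRecOn with
  | nil => intros; simp
  | append_singleton l b ih =>
    intro hs h0 hp x hx
    rw [List.pairwise_append] at hs
    have h1 := ih hs.1 (fun i hi => h0 i (by simp [hi])) (fun s hsl => by
      have := hp s (by simp; omega)
      rwa [List.take_append_of_le_length hsl] at this) (a b)
      (fun i hi => hs.2.2 i hi b (by simp))
    have h2 := hp (l ++ [b]).length le_rfl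
    rw [List.take_length] at h2
    have h3 := hx b (by simp)
    simp only [List.map_append, List.sum_append, List.map_cons, List.map_nil, List.sum_cons,
      List.sum_nil, add_zero] at h2 ⊢
    nlinarith

lemma sum_map_indicator_sub (l : List ι) (hl : l.Nodup) (W : Finset ι) (a : ι → ℝ) :
    (l.map fun i => a i * ((if i ∈ W then 2 else 0) - 1)).sum =
      2 * ∑ i ∈ l.toFinset ∩ W, a i - ∑ i ∈ l.toFinset, a i := by
  rw [← List.sum_toFinset _ hl]
  simp only [mul_sub, mul_one, Finset.sum_sub_distrib, mul_ite, mul_zero]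
  rw [Finset.sum_ite_mem, Finset.mul_sum]
  congr 1
  exact Finset.sum_congr rfl fun _ _ => mul_comm _ _

/-- Abel summation with coefficient +1 on `W` and -1 off `W`; the partial sums are nonnegative
exactly when `W` holds at least half of each initial segment. -/
lemma sum_le_two_mul_sum_inter (a : ι → ℝ) (ha : ∀ i, 0 ≤ a i) (l : List ι) (hl : l.Nodup)
    (hs : l.Pairwise fun i j => a j ≤ a i) (W : Finset ι)
    (h : ∀ s, 0 < s → s ≤ l.length → s ≤ 2 * ((l.take s).toFinset ∩ W).card) :
    ∑ i ∈ l.toFinset, a i ≤ 2 * ∑ i ∈ l.toFinset ∩ W, a i := by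
  have := sum_map_mul_ge_of_partial_sums_nonneg a (fun i => (if i ∈ W then 2 else 0) - 1) l hs
    (fun i _ => ha i) (fun s hsl => by
      have hn : (l.take s).Nodup := hl.sublist (List.take_sublist s l)
      have e := sum_map_indicator_sub (l.take s) hn W (fun _ => 1)
      simp only [one_mul] at e
      rw [e]
      rcases Nat.eq_zero_or_pos s with rfl | hpos
      · simp
      · have := h s hpos hsl
        simp only [sum_const, nsmul_eq_mul, mul_one, List.toFinset_card_of_nodup hn,
          List.length_take, min_eq_left hsl]
        have h' : (s : ℝ) ≤ 2 * (((l.take s).toFinset ∩ W).card : ℝ) := by exact_mod_cast this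
        linarith) 0 (fun i _ => ha i)
  rw [zero_mul, sum_map_indicator_sub l hl] at this
  linarith

lemma exists_sorted_list (a : ι → ℝ) (S : Finset ι) :
    ∃ l : List ι, l.Nodup ∧ l.toFinset = S ∧ l.Pairwise fun i j => a j ≤ a i := by
  refine ⟨S.toList.mergeSort fun i j => decide (a j ≤ a i), ?_, ?_, ?_⟩
  · exact (List.mergeSort_perm _ _).nodup_iff.2 S.nodup_toList
  · rw [List.toFinset_eq_of_perm _ _ (List.mergeSort_perm _ _), Finset.toList_toFinset]
  · have := List.pairwise_mergeSort (le := fun i j => decide (a j ≤ a i))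
      (fun i j k => by simpa using fun h1 h2 => h2.trans h1)
      (fun i j => by simpa using le_total _ _) S.toList
    simpa using this

open Classical in
/-- The first `t` entries of some `l ∈ C` which are contained in `Z` and such that `Z` contains
at least `s / 2 + k` of the first `s` entries of `l` for all larger `s`. -/
def decodeFragment (C : Set (List ι)) (Z : Finset ι) (t k : ℕ) : Finset ι :=
  if h : ∃ l ∈ C, t ≤ l.length ∧ (l.take t).toFinset ⊆ Z ∧
      ∀ s, t < s → s ≤ l.length → s + 2 * k ≤ 2 * ((l.take s).toFinset ∩ Z).card then
    (h.choose.take t).toFinset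
  else ∅

lemma card_decodeFragment_le (C : Set (List ι)) (Z : Finset ι) (t k : ℕ) :
    (decodeFragment C Z t k).card ≤ t := by
  unfold decodeFragment
  split_ifs
  · exact (List.toFinset_card_le _).trans (by simp)
  · simp

end Lists

/-! ### Random subsets, thinning and fragments. -/

variable {ι : Type*} [Fintype ι] [DecidableEq ι]

/-- The probability that a random subset, containing each `i` independently with probability `q i`,
equals `W`. -/
def bernoulliWeight (q : ι → ℝ) (W : Finset ι) : ℝ :=
  (∏ i ∈ W, q i) * ∏ i ∈ Wᶜ, (1 - q i)

lemma bernoulliWeight_nonneg {q : ι → ℝ} (h0 : ∀ i, 0 ≤ q i) (h1 : ∀ i, q i ≤ 1) (W : Finset ι) :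
    0 ≤ bernoulliWeight q W :=
  mul_nonneg (prod_nonneg fun i _ => h0 i) (prod_nonneg fun i _ => sub_nonneg.2 (h1 i))

lemma sum_bernoulliWeight (q : ι → ℝ) : ∑ W, bernoulliWeight q W = 1 := by
  have := Finset.prod_add q (fun i => 1 - q i) univ
  simp only [add_sub_cancel, prod_const_one, powerset_univ, ← compl_eq_univ_sdiff] at this
  exact this.symm

/-- The change of variables Z = W ∪ T for disjoint W and T. It serves both thinning (T discarded
from Z) and the counting of fragments by their union with W. -/
lemma sum_powerset_sdiff (f : Finset ι → Finset ι → ℝ) :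
    ∑ Z, ∑ T ∈ Z.powerset, f (Z \ T) T = ∑ W, ∑ T ∈ Wᶜ.powerset, f W T := by
  rw [Finset.sum_sigma', Finset.sum_sigma']
  refine Finset.sum_bij' (fun x _ => ⟨x.1 \ x.2, x.2⟩) (fun x _ => ⟨x.1 ∪ x.2, x.2⟩) ?_ ?_ ?_ ?_ ?_
  · rintro ⟨Z, T⟩ h
    simp only [mem_sigma, mem_univ, mem_powerset, true_and] at h ⊢
    intro i hi
    simp [hi]
  · rintro ⟨Z, T⟩ h
    simp only [mem_sigma, mem_univ, mem_powerset, true_and]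
    exact subset_union_right
  · rintro ⟨Z, T⟩ h
    simp only [mem_sigma, mem_univ, mem_powerset, true_and] at h
    simp [h]
  · rintro ⟨W, T⟩ h
    simp only [mem_sigma, mem_univ, mem_powerset, true_and] at h
    have : Disjoint W T := by
      rw [Finset.disjoint_left]
      intro i hW hT
      exact (mem_compl.1 (h hT)) hW
    simp [Finset.union_sdiff_cancel_right this]
  · rintro ⟨Z, T⟩ h
    rfl

/-- Keeping each element of a Kp-random set with probability 1/K produces a p-random set; `D` is
what was discarded. Outside `U` the factors add up as Kp(1 - 1/K) + (1 - Kp) = 1 - p. -/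
lemma bernoulliWeight_thinning (p : ι → ℝ) (K : ℝ) (hK : K ≠ 0) (U : Finset ι) :
    ∑ D ∈ Uᶜ.powerset,
      bernoulliWeight (fun i => K * p i) (U ∪ D) * (K⁻¹ ^ U.card * (1 - K⁻¹) ^ D.card) =
      bernoulliWeight p U := by
  have h := Finset.prod_add (fun i => K * p i * (1 - K⁻¹)) (fun i => 1 - K * p i) Uᶜ
  have h1 : ∀ i, K * p i * (1 - K⁻¹) + (1 - K * p i) = 1 - p i := by
    intro i; field_simp; ring
  simp only [h1] at h
  rw [bernoulliWeight, h, Finset.mul_sum]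
  refine Finset.sum_congr rfl fun D hD => ?_
  have hdis : Disjoint U D := by
    rw [Finset.disjoint_left]
    intro i hW hT
    exact (mem_compl.1 (mem_powerset.1 hD hT)) hW
  have hc : (U ∪ D)ᶜ = Uᶜ \ D := by
    ext i; simp
  rw [bernoulliWeight, hc, prod_union hdis]
  have hU : ∏ i ∈ U, p i = (∏ i ∈ U, K * p i) * K⁻¹ ^ U.card := by
    rw [← prod_const, ← prod_mul_distrib]
    exact prod_congr rfl fun i _ => by field_simp
  have hD' : ∏ i ∈ D, (K * p i * (1 - K⁻¹)) = (∏ i ∈ D, K * p i) * (1 - K⁻¹) ^ D.card := by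
    rw [← prod_const, ← prod_mul_distrib]
  rw [hU, hD']
  ring

/-- Fix the Kp-random set `W` and an index attaining its supremum. Thinning multiplies the mean of
that one linear sum by 1/K, so the mean supremum of the thinned set is at least 1/K times the value
at `W`. -/
lemma sum_bernoulliWeight_iSup_le {τ : Type*} [Finite τ] [Nonempty τ] (lam : τ → ι → ℝ)
    (p : ι → ℝ) (hp : ∀ i, 0 ≤ p i) {K : ℝ} (hK : 1 ≤ K) (hKp : ∀ i, K * p i ≤ 1) :
    ∑ W, bernoulliWeight (fun i => K * p i) W * (⨆ t, ∑ i ∈ W, lam t i) ≤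
      K * ∑ W, bernoulliWeight p W * (⨆ t, ∑ i ∈ W, lam t i) := by
  have hK0 : 0 < K := by linarith
  have hr : K⁻¹ ≤ 1 := inv_le_one_of_one_le₀ hK
  set M : Finset ι → ℝ := fun W => ⨆ t, ∑ i ∈ W, lam t i with hM
  have key : ∑ W, bernoulliWeight p W * M W = ∑ W, bernoulliWeight (fun i => K * p i) W *
      ∑ D ∈ W.powerset, K⁻¹ ^ (W \ D).card * (1 - K⁻¹) ^ D.card * M (W \ D) := by
    have := sum_powerset_sdiff (fun U D => bernoulliWeight (fun i => K * p i) (U ∪ D) *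
      (K⁻¹ ^ U.card * (1 - K⁻¹) ^ D.card) * M U)
    simp_rw [← Finset.sum_mul, bernoulliWeight_thinning p K hK0.ne'] at this
    rw [← this]
    refine Finset.sum_congr rfl fun W _ => ?_
    rw [Finset.mul_sum]
    refine Finset.sum_congr rfl fun D hD => ?_
    rw [Finset.sdiff_union_of_subset (mem_powerset.1 hD)]
    ring
  rw [key, Finset.mul_sum]
  refine Finset.sum_le_sum fun W _ => ?_
  obtain ⟨t, ht⟩ := exists_eq_ciSup_of_finite (f := fun t => ∑ i ∈ W, lam t i)
  have hMt : M W = ∑ i ∈ W, lam t i := ht.symm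
  have h1 : K⁻¹ * M W ≤
      ∑ D ∈ W.powerset, K⁻¹ ^ (W \ D).card * (1 - K⁻¹) ^ D.card * M (W \ D) := by
    rw [hMt, ← sum_powerset_binomial_weight_linear]
    refine Finset.sum_le_sum fun D _ => ?_
    refine mul_le_mul_of_nonneg_left ?_ ?_
    · exact le_ciSup (f := fun t => ∑ i ∈ W \ D, lam t i) (Set.finite_range _).bddAbove t
    · have : 0 ≤ 1 - K⁻¹ := by linarith
      positivity
  have hb := bernoulliWeight_nonneg (q := fun i => K * p i)
    (fun i => mul_nonneg hK0.le (hp i)) hKp W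
  calc bernoulliWeight (fun i => K * p i) W * M W
      = K * (bernoulliWeight (fun i => K * p i) W * (K⁻¹ * M W)) := by field_simp
    _ ≤ _ := by gcongr

/-- If `B Z t k` has at most `t` elements, the fragments `T` of `W` with `T ⊆ B (W ∪ T) t #T`
are cheap on average over `W`. -/
lemma sum_fragments_le (q x : ι → ℝ) (hq0 : ∀ i, 0 < q i) (hq1 : ∀ i, q i ≤ 1)
    (hx0 : ∀ i, 0 ≤ x i) {ρ : ℝ} (hρ0 : 0 ≤ ρ) (hρ1 : ρ ≤ 1)
    (hx : ∀ i, x i * (1 - q i) ≤ ρ ^ 2 * q i) (B : Finset ι → ℕ → ℕ → Finset ι)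
    (hB : ∀ Z t k, (B Z t k).card ≤ t) (t : ℕ) :
    ∑ W, bernoulliWeight q W * ∑ T ∈ Wᶜ.powerset with
      t < 2 * T.card ∧ T ⊆ B (W ∪ T) t T.card, ∏ i ∈ T, x i ≤ (2 * ρ) ^ t := by
  classical
  -- Moving `T` into the random set trades each factor x(1 - q) for at most ρ²q.
  have step : ∀ W, ∀ T ∈ Wᶜ.powerset, bernoulliWeight q W * ∏ i ∈ T, x i ≤
      bernoulliWeight q (W ∪ T) * (ρ ^ 2) ^ T.card := by
    intro W T hT
    have hdis : Disjoint W T := by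
      rw [Finset.disjoint_left]
      intro i hW hT'
      exact (mem_compl.1 (mem_powerset.1 hT hT')) hW
    have hc : Wᶜ = T ∪ (W ∪ T)ᶜ := by
      ext i
      have : i ∈ W → i ∉ T := fun h => Finset.disjoint_left.1 hdis h
      simp only [mem_compl, mem_union, not_or]
      tauto
    have hdis' : Disjoint T (W ∪ T)ᶜ := by
      rw [Finset.disjoint_left]; intro i hi; simp [hi]
    rw [bernoulliWeight, bernoulliWeight, hc, prod_union hdis', prod_union hdis]
    have e : (∏ i ∈ T, (1 - q i)) * ∏ i ∈ T, x i ≤ (∏ i ∈ T, q i) * (ρ ^ 2) ^ T.card := by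
      rw [← prod_const, ← prod_mul_distrib, ← prod_mul_distrib]
      refine prod_le_prod (fun i _ => mul_nonneg (sub_nonneg.2 (hq1 i)) (hx0 i)) fun i _ => ?_
      have := hx i
      linarith
    have e1 : 0 ≤ ∏ i ∈ W, q i := prod_nonneg fun i _ => (hq0 i).le
    have e2 : 0 ≤ ∏ i ∈ (W ∪ T)ᶜ, (1 - q i) := prod_nonneg fun i _ => sub_nonneg.2 (hq1 i)
    calc _ = (∏ i ∈ W, q i) * (∏ i ∈ (W ∪ T)ᶜ, (1 - q i)) *
          ((∏ i ∈ T, (1 - q i)) * ∏ i ∈ T, x i) := by ring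
      _ ≤ (∏ i ∈ W, q i) * (∏ i ∈ (W ∪ T)ᶜ, (1 - q i)) *
          ((∏ i ∈ T, q i) * (ρ ^ 2) ^ T.card) := by gcongr
      _ = _ := by ring
  set F : Finset ι → Finset ι → ℝ := fun W T =>
    if t < 2 * T.card ∧ T ⊆ B (W ∪ T) t T.card then
      bernoulliWeight q (W ∪ T) * (ρ ^ 2) ^ T.card else 0 with hF
  have h1 : ∑ W, bernoulliWeight q W * ∑ T ∈ Wᶜ.powerset with
      t < 2 * T.card ∧ T ⊆ B (W ∪ T) t T.card, ∏ i ∈ T, x i ≤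
      ∑ W, ∑ T ∈ Wᶜ.powerset, F W T := by
    refine Finset.sum_le_sum fun W _ => ?_
    rw [Finset.mul_sum, Finset.sum_filter]
    refine Finset.sum_le_sum fun T hT => ?_
    simp only [hF]
    split_ifs
    · exact step W T hT
    · exact le_rfl
  refine h1.trans ?_
  rw [← sum_powerset_sdiff]
  have h2 : ∀ Z : Finset ι, ∑ T ∈ Z.powerset, F (Z \ T) T ≤ bernoulliWeight q Z * (2 * ρ) ^ t := by
    intro Z
    have hbz := bernoulliWeight_nonneg (fun i => (hq0 i).le) hq1 Z
    have e1 : ∑ T ∈ Z.powerset, F (Z \ T) T ≤ ∑ T ∈ Z.powerset,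
        if T.card ≤ t ∧ T ⊆ B Z t T.card then bernoulliWeight q Z * ρ ^ t else 0 := by
      refine Finset.sum_le_sum fun T hT => ?_
      simp only [hF]
      rw [Finset.sdiff_union_of_subset (mem_powerset.1 hT)]
      split_ifs with ha hb hb
      · refine mul_le_mul_of_nonneg_left ?_ hbz
        rw [← pow_mul]
        exact pow_le_pow_of_le_one hρ0 hρ1 ha.1.le
      · exact absurd ⟨(card_le_card ha.2).trans (hB _ _ _), ha.2⟩ hb
      · positivity
      · exact le_rfl
    refine e1.trans ?_
    rw [← Finset.sum_filter, Finset.sum_const, nsmul_eq_mul]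
    -- For each cardinality k, `T` is a k-subset of a set of size at most t depending only on `Z`, t
    -- and k; the binomial coefficients sum to 2^t.
    have e2 : (({T ∈ Z.powerset | T.card ≤ t ∧ T ⊆ B Z t T.card}).card : ℝ) ≤ 2 ^ t := by
      have hsub : {T ∈ Z.powerset | T.card ≤ t ∧ T ⊆ B Z t T.card} ⊆
          (range (t + 1)).biUnion fun k => (B Z t k).powersetCard k := by
        intro T hT
        simp only [mem_filter, mem_powerset] at hT
        simp only [mem_biUnion, mem_range, mem_powersetCard]
        exact ⟨T.card, by omega, hT.2.2, rfl⟩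
      have hcard : ({T ∈ Z.powerset | T.card ≤ t ∧ T ⊆ B Z t T.card}).card ≤ 2 ^ t := by
        refine (card_le_card hsub).trans (card_biUnion_le.trans ?_)
        rw [← Nat.sum_range_choose]
        refine Finset.sum_le_sum fun k _ => ?_
        rw [card_powersetCard]
        exact Nat.choose_le_choose k (hB _ _ _)
      exact_mod_cast hcard
    rw [mul_pow]
    calc _ ≤ 2 ^ t * (bernoulliWeight q Z * ρ ^ t) := by gcongr
      _ = _ := by ring
  calc ∑ Z, ∑ T ∈ Z.powerset, F (Z \ T) T ≤ ∑ Z, bernoulliWeight q Z * (2 * ρ) ^ t :=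
        Finset.sum_le_sum fun Z _ => h2 Z
    _ = (2 * ρ) ^ t := by rw [← Finset.sum_mul, sum_bernoulliWeight, one_mul]

/-- The Park–Pham fragment: if no `l ∈ C` has at least half of each of its initial segments in `W`,
then every `l₀ ∈ C` contains a fragment `T`, disjoint from `W`, which is determined by `W ∪ T`
up to few choices. -/
lemma exists_fragment (C : Set (List ι)) (hC : ∀ l ∈ C, l.Nodup) (W : Finset ι)
    (hW : ∀ l ∈ C, ∃ s, 0 < s ∧ s ≤ l.length ∧ 2 * ((l.take s).toFinset ∩ W).card < s)
    {l₀ : List ι} (hl₀ : l₀ ∈ C) :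
    ∃ T ⊆ l₀.toFinset, T ⊆ Wᶜ ∧ ∃ t, 0 < t ∧ t ≤ Fintype.card ι ∧ t < 2 * T.card ∧
      T ⊆ decodeFragment C (W ∪ T) t T.card := by
  classical
  -- The pair (l, t) is chosen with t minimal, then with the fewest of the first t entries outside
  -- `W`. Minimality of t makes the fragment large, the second minimality makes it decodable.
  let cand : List ι → ℕ → Prop := fun l t => l ∈ C ∧ t ≤ l.length ∧
    (l.take t).toFinset ⊆ W ∪ l₀.toFinset ∧
    ∀ s, t < s → s ≤ l.length → s ≤ 2 * ((l.take s).toFinset ∩ W).card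
  have hex : ∃ t, ∃ l, cand l t := by
    refine ⟨l₀.length, l₀, hl₀, le_rfl, ?_, fun s h1 h2 => absurd h1 (by omega)⟩
    rw [List.take_length]
    exact subset_union_right
  obtain ⟨t, ht, htmin⟩ : ∃ t, (∃ l, cand l t) ∧ ∀ t' < t, ¬ ∃ l, cand l t' :=
    ⟨Nat.find hex, Nat.find_spec hex, fun t' h => Nat.find_min hex h⟩
  have hex2 : ∃ k, ∃ l, cand l t ∧ ((l.take t).toFinset \ W).card = k := by
    obtain ⟨l, hl⟩ := ht
    exact ⟨_, l, hl, rfl⟩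
  obtain ⟨l, hl, hkmin⟩ : ∃ l, cand l t ∧ ∀ l', cand l' t →
      ((l.take t).toFinset \ W).card ≤ ((l'.take t).toFinset \ W).card := by
    obtain ⟨l, hl, hk⟩ := Nat.find_spec hex2
    exact ⟨l, hl, fun l' hl' => hk ▸ Nat.find_min' hex2 ⟨l', hl', rfl⟩⟩
  obtain ⟨hlC, hlt, hlsub, hls⟩ := hl
  have hlen : ∀ s ≤ l.length, ((l.take s).toFinset).card = s := fun s hs => by
    rw [List.toFinset_card_of_nodup ((hC l hlC).sublist (List.take_sublist s l)),
      List.length_take, min_eq_left hs]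
  have htpos : 0 < t := by
    rcases Nat.eq_zero_or_pos t with rfl | h
    · obtain ⟨s, hs0, hsl, hs⟩ := hW l hlC
      exact absurd (hls s hs0 hsl) (by omega)
    · exact h
  have hmono : ∀ (l : List ι) (s : ℕ), t ≤ s → (l.take t).toFinset ⊆ (l.take s).toFinset := by
    intro l s hts i hi
    rw [List.mem_toFinset] at hi ⊢
    exact (List.take_subset_take_left l hts) hi
  -- Otherwise t - 1 would also be admissible for the same list.
  have hsmall : 2 * ((l.take t).toFinset ∩ W).card < t := by
    by_contra hcon
    push Not at hcon
    refine htmin (t - 1) (by omega) ⟨l, hlC, by omega, ?_, fun s h1 h2 => ?_⟩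
    · intro i hi
      apply hlsub
      rw [List.mem_toFinset] at hi ⊢
      exact (List.take_subset_take_left l (by omega : t - 1 ≤ t)) hi
    · rcases eq_or_ne s t with rfl | h
      · exact hcon
      · exact hls s (by omega) h2
  set T := (l.take t).toFinset \ W with hT
  have hTW : Disjoint T W := sdiff_disjoint
  have hcardT : T.card + ((l.take t).toFinset ∩ W).card = t := by
    rw [hT, card_sdiff_add_card_inter, hlen t hlt]
  have hTsub : T ⊆ l₀.toFinset := by
    intro i hi
    have h1 := (mem_sdiff.1 hi)
    exact (mem_union.1 (hlsub h1.1)).resolve_left h1.2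
  refine ⟨T, hTsub, ?_, t, htpos, ?_, by omega, ?_⟩
  · intro i hi
    exact mem_compl.2 (mem_sdiff.1 hi).2
  · rw [← hlen t hlt]; exact card_le_univ _
  have hdec : ∃ l ∈ C, t ≤ l.length ∧ (l.take t).toFinset ⊆ W ∪ T ∧
      ∀ s, t < s → s ≤ l.length → s + 2 * T.card ≤ 2 * ((l.take s).toFinset ∩ (W ∪ T)).card := by
    refine ⟨l, hlC, hlt, ?_, fun s h1 h2 => ?_⟩
    · rw [hT, union_sdiff_self_eq_union]; exact subset_union_right
    · have h3 := hls s h1 h2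
      have h4 : (l.take s).toFinset ∩ (W ∪ T) = ((l.take s).toFinset ∩ W) ∪ T := by
        rw [inter_union_distrib_left]
        congr 1
        exact inter_eq_right.2 (sdiff_subset.trans (hmono l s h1.le))
      rw [h4, card_union_of_disjoint (hTW.symm.mono_left inter_subset_right)]
      omega
  rw [decodeFragment, dif_pos hdec]
  obtain ⟨hmC, hmt, hmsub, hms⟩ := hdec.choose_spec
  set m := hdec.choose
  have hsub : (m.take t).toFinset \ W ⊆ T := by
    intro i hi
    have h1 := mem_sdiff.1 hi
    exact (mem_union.1 (hmsub h1.1)).resolve_left h1.2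
  -- Removing `T` from `W ∪ T` costs at most `T.card` entries of each initial segment, which the
  -- surplus demanded by the decoder pays for. So the decoded list is a candidate, and the second
  -- minimality forces it to leave the same fragment.
  have hcand : cand m t := by
    refine ⟨hmC, hmt, hmsub.trans (union_subset_union_right hTsub), fun s h1 h2 => ?_⟩
    have h3 := hms s h1 h2
    have h4 : ((m.take s).toFinset ∩ (W ∪ T)).card ≤
        ((m.take s).toFinset ∩ W).card + T.card := by
      rw [inter_union_distrib_left]
      exact (card_union_le _ _).trans (Nat.add_le_add_left (card_le_card inter_subset_right) _)
    omega
  have heq := eq_of_subset_of_card_le hsub (hkmin m hcand)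
  rw [← heq]
  exact sdiff_subset

lemma sum_range_geometric_le (N : ℕ) : ∑ t ∈ range N, (1 / 20 : ℝ) ^ (t + 1) ≤ 1 / 19 := by
  have : ∀ N, ∑ t ∈ range N, (1 / 20 : ℝ) ^ (t + 1) = 1 / 19 - 1 / 19 * (1 / 20) ^ N := by
    intro N
    induction N with
    | zero => simp
    | succ n ih => rw [sum_range_succ, ih]; ring
  rw [this]
  have : (0 : ℝ) ≤ (1 / 20) ^ N := by positivity
  linarith

/-- The Park–Pham theorem on positive selector processes. -/
theorem exists_selector_cover {τ : Type*} [Finite τ] [Nonempty τ] (lam : τ → ι → ℝ)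
    (hlam : ∀ t i, 0 ≤ lam t i) (p : ι → ℝ) (hp : ∀ i, 0 < p i) {c : ℝ} (hc : 1 ≤ c)
    (hcp : ∀ i, 1600 * c * p i ≤ 1) {E : ℝ} (hE : 0 < E)
    (hpE : ∑ W, bernoulliWeight p W * (⨆ t, ∑ i ∈ W, lam t i) ≤ E) :
    ∃ G : Finset (Finset ι),
      (∀ S t, 4 * (1600 * c) * E ≤ ∑ i ∈ S, lam t i → ∃ T ∈ G, T ⊆ S) ∧
      ∑ T ∈ G, ∏ i ∈ T, (c * p i) ≤ 1 / 4 := by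
  classical
  set K := 1600 * c with hK
  have hK1 : 1 ≤ K := by linarith
  set q : ι → ℝ := fun i => K * p i with hq
  have hq0 : ∀ i, 0 < q i := fun i => mul_pos (by linarith) (hp i)
  set M : Finset ι → ℝ := fun W => ⨆ t, ∑ i ∈ W, lam t i with hM
  have hMt : ∀ W t, ∑ i ∈ W, lam t i ≤ M W := fun W t =>
    le_ciSup (f := fun t => ∑ i ∈ W, lam t i) (Set.finite_range _).bddAbove t
  have hM0 : ∀ W, 0 ≤ M W := fun W =>
    (sum_nonneg fun i _ => hlam (Classical.arbitrary τ) i).trans (hMt W _)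
  have hbw : ∀ W, 0 ≤ bernoulliWeight q W :=
    bernoulliWeight_nonneg (fun i => (hq0 i).le) hcp
  have hqE : ∑ W, bernoulliWeight q W * M W ≤ K * E :=
    (sum_bernoulliWeight_iSup_le lam p (fun i => (hp i).le) hK1 hcp).trans (by gcongr)
  set C : Set (List ι) := {l | l.Nodup ∧ ∃ t, l.Pairwise (fun i j => lam t j ≤ lam t i) ∧
    4 * K * E ≤ ∑ i ∈ l.toFinset, lam t i} with hC
  -- All fragments that decoding could produce from `W`; the shift t + 1 runs over the positive
  -- lengths up to the cardinality of `ι`.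
  set G : Finset ι → Finset (Finset ι) := fun W => {T ∈ Wᶜ.powerset |
    ∃ t ∈ range (Fintype.card ι), t + 1 < 2 * T.card ∧
      T ⊆ decodeFragment C (W ∪ T) (t + 1) T.card} with hG
  set cost : Finset ι → ℝ := fun W => ∑ T ∈ G W, ∏ i ∈ T, (c * p i) with hcost
  have hcp0 : ∀ i, 0 ≤ c * p i := fun i => mul_nonneg (by linarith) (hp i).le
  have hcost0 : ∀ W, 0 ≤ cost W := fun W => sum_nonneg fun T _ => prod_nonneg fun i _ => hcp0 i
  have hmean : ∑ W, bernoulliWeight q W * cost W ≤ 1 / 19 := by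
    have h1 : ∀ W, cost W ≤ ∑ t ∈ range (Fintype.card ι), ∑ T ∈ Wᶜ.powerset with
        t + 1 < 2 * T.card ∧ T ⊆ decodeFragment C (W ∪ T) (t + 1) T.card,
          ∏ i ∈ T, (c * p i) := by
      intro W
      simp only [Finset.sum_filter, hcost, hG]
      rw [Finset.sum_comm]
      refine Finset.sum_le_sum fun T _ => ?_
      have hnn : 0 ≤ ∏ i ∈ T, (c * p i) := prod_nonneg fun i _ => hcp0 i
      split_ifs with h
      · obtain ⟨t, ht, h⟩ := h
        refine le_trans (le_of_eq ?_) (Finset.single_le_sum (f := fun t =>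
          if t + 1 < 2 * T.card ∧ T ⊆ decodeFragment C (W ∪ T) (t + 1) T.card then
            ∏ i ∈ T, (c * p i) else 0) (fun s _ => ?_) ht)
        · exact (if_pos h).symm
        · split_ifs; exacts [hnn, le_rfl]
      · refine Finset.sum_nonneg fun s _ => ?_
        split_ifs; exacts [hnn, le_rfl]
    calc ∑ W, bernoulliWeight q W * cost W
        ≤ ∑ W, bernoulliWeight q W * ∑ t ∈ range (Fintype.card ι), ∑ T ∈ Wᶜ.powerset with
          t + 1 < 2 * T.card ∧ T ⊆ decodeFragment C (W ∪ T) (t + 1) T.card,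
            ∏ i ∈ T, (c * p i) :=
          Finset.sum_le_sum fun W _ => mul_le_mul_of_nonneg_left (h1 W) (hbw W)
      _ = ∑ t ∈ range (Fintype.card ι), ∑ W, bernoulliWeight q W * ∑ T ∈ Wᶜ.powerset with
          t + 1 < 2 * T.card ∧ T ⊆ decodeFragment C (W ∪ T) (t + 1) T.card,
            ∏ i ∈ T, (c * p i) := by
          simp_rw [Finset.mul_sum (range _)]
          rw [Finset.sum_comm]
      _ ≤ ∑ t ∈ range (Fintype.card ι), (1 / 20 : ℝ) ^ (t + 1) := by
          refine Finset.sum_le_sum fun t _ => ?_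
          -- The ratio of c·p to q = 1600·c·p is 1/1600 = (1/40)², so ρ = 1/40 and 2ρ = 1/20.
          refine (sum_fragments_le q (fun i => c * p i) hq0 hcp hcp0 (ρ := 1 / 40) (by norm_num)
            (by norm_num) (fun i => ?_) (decodeFragment C)
            (card_decodeFragment_le C) (t + 1)).trans (by norm_num)
          have : c * p i * (1 - q i) ≤ c * p i * 1 :=
            mul_le_mul_of_nonneg_left (by linarith [hq0 i]) (hcp0 i)
          simp only [hq, hK] at this ⊢
          linarith
      _ ≤ 1 / 19 := sum_range_geometric_le _
  -- First moment: if every `W` failed, cost + M/(8KE) would be at least 1/4 everywhere, whereas its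
  -- mean is at most 1/19 + 1/8.
  obtain ⟨W, hWbad, hWcost⟩ : ∃ W, M W < 2 * K * E ∧ cost W ≤ 1 / 4 := by
    by_contra! hcon
    have h1 : ∀ W, bernoulliWeight q W * (1 / 4) ≤
        bernoulliWeight q W * cost W + bernoulliWeight q W * M W / (8 * K * E) := by
      intro W
      have hKE : 0 < K * E := mul_pos (by linarith) hE
      rw [mul_div_assoc, ← mul_add]
      refine mul_le_mul_of_nonneg_left ?_ (hbw W)
      rcases lt_or_ge (M W) (2 * K * E) with h | h
      · have := hcon W h
        have : 0 ≤ M W / (8 * K * E) := div_nonneg (hM0 W) (by linarith)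
        linarith
      · have : 1 / 4 ≤ M W / (8 * K * E) := by
          rw [le_div_iff₀ (by linarith)]; linarith
        have := hcost0 W
        linarith
    have h2 := Finset.sum_le_sum fun W (_ : W ∈ univ) => h1 W
    rw [← Finset.sum_mul, sum_bernoulliWeight, Finset.sum_add_distrib, ← Finset.sum_div] at h2
    have h3 : (∑ W, bernoulliWeight q W * M W) / (8 * K * E) ≤ 1 / 8 := by
      have hKE : 0 < K * E := mul_pos (by linarith) hE
      rw [div_le_iff₀ (by linarith)]; linarith
    linarith
  refine ⟨G W, fun S t hS => ?_, hWcost⟩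
  obtain ⟨l₀, hnd, hlS, hsort⟩ := exists_sorted_list (lam t) S
  have hl₀ : l₀ ∈ C := ⟨hnd, t, hsort, hlS ▸ hS⟩
  obtain ⟨T, hTl, hTW, s, hs0, hsN, hsT, hTd⟩ := exists_fragment C (fun l hl => hl.1) W
    (fun l hl => by
      -- If `W` held half of every initial segment, it would carry half of the total 4KE,
      -- contradicting M W < 2KE.
      by_contra! hcon
      obtain ⟨hnd', u, hsort', hbig⟩ := hl
      have h1 := sum_le_two_mul_sum_inter (lam u) (hlam u) l hnd' hsort' W hcon
      have h2 : ∑ i ∈ l.toFinset ∩ W, lam u i ≤ ∑ i ∈ W, lam u i :=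
        Finset.sum_le_sum_of_subset_of_nonneg inter_subset_right fun i _ _ => hlam u i
      have h3 := hMt W u
      linarith) hl₀
  refine ⟨T, ?_, hlS ▸ hTl⟩
  simp only [hG, mem_filter, mem_powerset, mem_range]
  exact ⟨hTW, s - 1, by omega, by rwa [Nat.sub_add_cancel hs0], by rwa [Nat.sub_add_cancel hs0]⟩

end Combinatorics

/-! ### Sums over Poisson points: moments, Campbell's formula and tail bounds. -/

section PoissonProcess

variable {Ω E : Type*}

lemma absSum_eq_tsum_ite (κ : Ω → ℕ∞) (Y : ℕ → Ω → E) (f : E → ℝ) (ω : Ω) :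
    absSum κ Y f ω = ∑' i : ℕ, if (i : ℕ∞) < κ ω then ENNReal.ofReal |f (Y i ω)| else 0 := by
  rw [absSum]
  exact (tsum_subtype {i : ℕ | (i : ℕ∞) < κ ω} fun i => ENNReal.ofReal |f (Y i ω)|).trans
    (tsum_congr fun i => by simp [Set.indicator])

lemma absSum_indicator (κ : Ω → ℕ∞) (Y : ℕ → Ω → E) (A : Set E) (ω : Ω) :
    absSum κ Y (A.indicator 1) ω = (pointCount κ Y A ω : ℝ≥0∞) := by
  classical
  rw [absSum_eq_tsum_ite, pointCount, ← ENNReal.tsum_set_one, tsum_subtype _ fun _ => 1]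
  refine tsum_congr fun i => ?_
  by_cases h1 : (i : ℕ∞) < κ ω <;> by_cases h2 : Y i ω ∈ A <;> simp [Set.indicator, h1, h2]

lemma absSum_mono (κ : Ω → ℕ∞) (Y : ℕ → Ω → E) {f g : E → ℝ} (h : ∀ x, |f x| ≤ |g x|) (ω : Ω) :
    absSum κ Y f ω ≤ absSum κ Y g ω :=
  ENNReal.tsum_le_tsum fun _ => ENNReal.ofReal_le_ofReal (h _)

lemma absSum_add (κ : Ω → ℕ∞) (Y : ℕ → Ω → E) {f g : E → ℝ} (hf : ∀ x, 0 ≤ f x)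
    (hg : ∀ x, 0 ≤ g x) (ω : Ω) :
    absSum κ Y (fun x => f x + g x) ω = absSum κ Y f ω + absSum κ Y g ω := by
  rw [absSum, absSum, absSum, ← ENNReal.tsum_add]
  refine tsum_congr fun i => ?_
  rw [abs_of_nonneg (hf _), abs_of_nonneg (hg _), abs_of_nonneg (add_nonneg (hf _) (hg _)),
    ENNReal.ofReal_add (hf _) (hg _)]

lemma absSum_sum_indicator {ι : Type*} (κ : Ω → ℕ∞) (Y : ℕ → Ω → E) (s : Finset ι) (c : ι → ℝ)
    (hc : ∀ i ∈ s, 0 ≤ c i) (Q : ι → Set E) (ω : Ω) :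
    absSum κ Y (fun x => ∑ i ∈ s, c i * (Q i).indicator 1 x) ω =
      ∑ i ∈ s, ENNReal.ofReal (c i) * (pointCount κ Y (Q i) ω : ℝ≥0∞) := by
  have hnn : ∀ i ∈ s, ∀ x : E, 0 ≤ c i * (Q i).indicator 1 x := fun i hi x =>
    mul_nonneg (hc i hi) (Set.indicator_nonneg (fun _ _ => zero_le_one) x)
  simp_rw [← absSum_indicator, absSum, ← ENNReal.tsum_mul_left]
  rw [← Summable.tsum_finsetSum fun _ _ => ENNReal.summable]
  refine tsum_congr fun k => ?_
  rw [abs_of_nonneg (Finset.sum_nonneg fun i hi => hnn i hi _),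
    ENNReal.ofReal_sum_of_nonneg fun i hi => hnn i hi _]
  refine Finset.sum_congr rfl fun i hi => ?_
  have h01 : (0 : ℝ) ≤ (Q i).indicator 1 (Y k ω) :=
    Set.indicator_nonneg (fun _ _ => zero_le_one) _
  rw [ENNReal.ofReal_mul (hc i hi), abs_of_nonneg h01]

lemma tsum_poisson_mul (r : ℝ≥0) :
    ∑' n : ℕ, (n : ℝ≥0∞) * ENNReal.ofReal (Real.exp (-r) * (r : ℝ) ^ n / n.factorial) = r := by
  rw [tsum_eq_zero_add' ENNReal.summable]
  have h : ∀ n : ℕ, ((n + 1 : ℕ) : ℝ≥0∞) *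
      ENNReal.ofReal (Real.exp (-r) * (r : ℝ) ^ (n + 1) / (n + 1).factorial) =
      r * ENNReal.ofReal (Real.exp (-r) * (r : ℝ) ^ n / n.factorial) := by
    intro n
    rw [← ENNReal.ofReal_natCast, ← ENNReal.ofReal_coe_nnreal, ← ENNReal.ofReal_mul (by positivity),
      ← ENNReal.ofReal_mul (by positivity)]
    congr 1
    rw [Nat.factorial_succ]
    push_cast
    field_simp
    ring
  simp_rw [h, ENNReal.tsum_mul_left]
  rw [← ENNReal.ofReal_tsum_of_nonneg (fun n => by positivity)
    (hasSum_one_poissonMeasure r).summable, (hasSum_one_poissonMeasure r).tsum_eq]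
  simp

/-- The powers of r cancel, leaving exp(-r) times the exponential series at 1. -/
lemma tsum_poisson_inv_pow_mul (r : ℝ≥0) (hr : 0 < r) :
    ∑' n : ℕ, ENNReal.ofReal ((r : ℝ)⁻¹ ^ n) *
      ENNReal.ofReal (Real.exp (-r) * (r : ℝ) ^ n / n.factorial) ≤
      ENNReal.ofReal (Real.exp 1) := by
  have hr' : (0 : ℝ) < r := hr
  have h : ∀ n : ℕ, ENNReal.ofReal ((r : ℝ)⁻¹ ^ n) *
      ENNReal.ofReal (Real.exp (-r) * (r : ℝ) ^ n / n.factorial) ≤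
      ENNReal.ofReal ((1 : ℝ) ^ n / n.factorial) := by
    intro n
    rw [← ENNReal.ofReal_mul (by positivity)]
    refine ENNReal.ofReal_le_ofReal ?_
    have : Real.exp (-r) ≤ 1 := Real.exp_le_one_iff.2 (by linarith)
    calc (r : ℝ)⁻¹ ^ n * (Real.exp (-r) * (r : ℝ) ^ n / n.factorial)
        = Real.exp (-r) / n.factorial := by rw [inv_pow]; field_simp
      _ ≤ (1 : ℝ) ^ n / n.factorial := by rw [one_pow]; gcongr
  refine (ENNReal.tsum_le_tsum h).trans ?_
  have hs := NormedSpace.expSeries_div_hasSum_exp (1 : ℝ)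
  rw [← ENNReal.ofReal_tsum_of_nonneg (fun n => by positivity) hs.summable, hs.tsum_eq,
    ← Real.exp_eq_exp_ℝ]

namespace IsPoissonPointProcess

variable [MeasurableSpace Ω] [MeasurableSpace E] {κ : Ω → ℕ∞} {Y : ℕ → Ω → E} {ν : Measure E}
  {P : Measure Ω}

lemma measurableSet_present (h : IsPoissonPointProcess κ Y ν P) (i : ℕ) :
    MeasurableSet {ω | (i : ℕ∞) < κ ω} :=
  h.measurable_total (MeasurableSet.of_discrete (s := Set.Ioi (i : ℕ∞)))

lemma measurable_absSum (h : IsPoissonPointProcess κ Y ν P) {f : E → ℝ} (hf : Measurable f) :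
    Measurable (absSum κ Y f) := by
  rw [show absSum κ Y f = fun ω => ∑' i : ℕ, if (i : ℕ∞) < κ ω then
    ENNReal.ofReal |f (Y i ω)| else 0 from funext (absSum_eq_tsum_ite κ Y f)]
  refine Measurable.tsum fun i => ?_
  refine Measurable.ite (h.measurableSet_present i) ?_ measurable_const
  have := (measurable_norm.comp (hf.comp (h.measurable_point i))).ennreal_ofReal
  exact this

lemma measurable_pointCount (h : IsPoissonPointProcess κ Y ν P) {A : Set E}
    (hA : MeasurableSet A) : Measurable (pointCount κ Y A) := by
  refine measurable_to_countable' fun n => ?_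
  have h1 : pointCount κ Y A ⁻¹' {n} = absSum κ Y (A.indicator 1) ⁻¹' {(n : ℝ≥0∞)} := by
    ext ω
    simp [absSum_indicator]
  rw [h1]
  exact h.measurable_absSum (measurable_one.indicator hA) (measurableSet_singleton _)

lemma iIndepFun_pointCount {ι : Type*} [Fintype ι] (h : IsPoissonPointProcess κ Y ν P) (Q : ι → Set E)
    (hQ : ∀ i, MeasurableSet (Q i)) (hd : Pairwise fun i j => Disjoint (Q i) (Q j)) :
    iIndepFun (fun i => pointCount κ Y (Q i)) P := by
  let e := Fintype.equivFin ι
  have h1 := h.indep (Fintype.card ι) (fun k => Q (e.symm k)) (fun k => hQ _)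
    (fun k l hkl => hd (e.symm.injective.ne hkl))
  have h2 := h1.precomp e.injective
  simpa using h2

lemma measure_pointCount_eq_zero (h : IsPoissonPointProcess κ Y ν P) {A : Set E}
    (hA : MeasurableSet A) (hν : ν A ≠ ∞) :
    P (pointCount κ Y A ⁻¹' {0}) = ENNReal.ofReal (Real.exp (-(ν A).toReal)) := by
  have := h.poisson_law A hA hν 0
  rw [poissonMeasure_singleton] at this
  simp only [Nat.cast_zero, pow_zero, mul_one, Nat.factorial_zero, Nat.cast_one, div_one] at this
  exact this

variable [IsProbabilityMeasure P]

lemma map_pointCount (h : IsPoissonPointProcess κ Y ν P) {A : Set E} (hA : MeasurableSet A)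
    (hν : ν A ≠ ∞) :
    P.map (pointCount κ Y A) = (poissonMeasure (ν A).toNNReal).map (Nat.cast : ℕ → ℕ∞) := by
  have hm := h.measurable_pointCount hA
  have hprob : IsProbabilityMeasure (P.map (pointCount κ Y A)) :=
    Measure.isProbabilityMeasure_map hm.aemeasurable
  have hn : ∀ n : ℕ, P.map (pointCount κ Y A) {(n : ℕ∞)} = poissonMeasure (ν A).toNNReal {n} := by
    intro n
    rw [Measure.map_apply hm (measurableSet_singleton _)]
    exact h.poisson_law A hA hν n
  refine Measure.ext_of_singleton fun a => ?_
  rw [Measure.map_apply (μ := poissonMeasure _) .of_discrete (measurableSet_singleton a)]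
  induction a using ENat.recTopCoe with
  | top =>
    have h1 : (Nat.cast : ℕ → ℕ∞) ⁻¹' {⊤} = ∅ := by ext; simp
    rw [h1, measure_empty]
    -- The finite values already carry total mass one, so infinity has mass zero.
    have h2 : ({⊤} : Set ℕ∞) = (⋃ n : ℕ, {(n : ℕ∞)})ᶜ := by
      ext a
      induction a using ENat.recTopCoe <;> simp
    rw [h2, prob_compl_eq_zero_iff MeasurableSet.of_discrete, measure_iUnion _
      (fun _ => measurableSet_singleton _)]
    · simp_rw [hn]
      rw [← measure_iUnion _ (fun _ => measurableSet_singleton _)]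
      · rw [Set.iUnion_of_singleton, measure_univ]
      · intro i j hij
        simpa using hij
    · intro i j hij
      simpa using hij
  | coe n =>
    rw [hn]
    congr 1
    ext; simp

lemma lintegral_comp_pointCount (h : IsPoissonPointProcess κ Y ν P) {A : Set E}
    (hA : MeasurableSet A) (hν : ν A ≠ ∞) (g : ℕ∞ → ℝ≥0∞) :
    ∫⁻ ω, g (pointCount κ Y A ω) ∂P = ∑' n : ℕ, g n * ENNReal.ofReal
      (Real.exp (-(ν A).toNNReal) * ((ν A).toNNReal : ℝ) ^ n / n.factorial) := by
  rw [← lintegral_map (f := g) (g := pointCount κ Y A) .of_discrete (h.measurable_pointCount hA),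
    h.map_pointCount hA hν, lintegral_map .of_discrete .of_discrete, lintegral_countable']
  simp_rw [poissonMeasure_singleton]

lemma lintegral_pointCount (h : IsPoissonPointProcess κ Y ν P) {A : Set E}
    (hA : MeasurableSet A) : ∫⁻ ω, (pointCount κ Y A ω : ℝ≥0∞) ∂P = ν A := by
  by_cases hν : ν A = ∞
  · rw [hν, lintegral_congr_ae (g := fun _ => ∞)]
    · simp
    · filter_upwards [h.infinite_law A hA hν] with ω hω
      simp [hω]
  · rw [h.lintegral_comp_pointCount hA hν (fun n => (n : ℝ≥0∞))]
    simp only [ENat.toENNReal_coe]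
    rw [tsum_poisson_mul, ENNReal.coe_toNNReal hν]

/-- Campbell's formula. -/
lemma lintegral_absSum (h : IsPoissonPointProcess κ Y ν P) {f : E → ℝ} (hf : Measurable f) :
    ∫⁻ ω, absSum κ Y f ω ∂P = ∫⁻ x, ENNReal.ofReal |f x| ∂ν := by
  -- The mean of the sum is an integral against the sum of the laws of the present points. Testing
  -- on indicators then identifies that measure with `ν`.
  have key : ∀ f : E → ℝ, Measurable f → ∫⁻ ω, absSum κ Y f ω ∂P = ∫⁻ x, ENNReal.ofReal |f x|
      ∂(Measure.sum fun i : ℕ => (P.restrict {ω | (i : ℕ∞) < κ ω}).map (Y i)) := by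
    intro f hf
    have hf' : Measurable fun x => ENNReal.ofReal |f x| :=
      (measurable_norm.comp hf).ennreal_ofReal
    rw [lintegral_sum_measure]
    simp_rw [absSum_eq_tsum_ite]
    have hm : ∀ i : ℕ, Measurable fun ω =>
        if (i : ℕ∞) < κ ω then ENNReal.ofReal |f (Y i ω)| else 0 := fun i =>
      Measurable.ite (h.measurableSet_present i) (hf'.comp (h.measurable_point i)) measurable_const
    rw [lintegral_tsum fun i => (hm i).aemeasurable]
    refine tsum_congr fun i => ?_
    rw [lintegral_map hf' (h.measurable_point i), ← lintegral_indicator (h.measurableSet_present i)]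
    exact lintegral_congr fun ω => by simp [Set.indicator]
  rw [key f hf]
  congr 1
  refine Measure.ext fun A hA => ?_
  have := key (A.indicator 1) (measurable_one.indicator hA)
  simp_rw [absSum_indicator] at this
  rw [h.lintegral_pointCount hA] at this
  rw [this, ← lintegral_indicator_one hA]
  refine lintegral_congr fun x => ?_
  by_cases hx : x ∈ A <;> simp [hx]

lemma measure_le_absSum (h : IsPoissonPointProcess κ Y ν P) {f : E → ℝ} (hf : Measurable f)
    {u : ℝ} (hu : 0 < u) :
    P {ω | ENNReal.ofReal u ≤ absSum κ Y f ω} ≤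
      (∫⁻ x, ENNReal.ofReal |f x| ∂ν) / ENNReal.ofReal u := by
  rw [← h.lintegral_absSum hf]
  exact meas_ge_le_lintegral_div (h.measurable_absSum hf).aemeasurable
    (ENNReal.ofReal_pos.2 hu).ne' ENNReal.ofReal_ne_top

lemma measure_two_le_pointCount (h : IsPoissonPointProcess κ Y ν P) {A : Set E}
    (hA : MeasurableSet A) (hν : ν A ≠ ∞) :
    P {ω | 2 ≤ pointCount κ Y A ω} ≤ ENNReal.ofReal ((ν A).toReal ^ 2) := by
  set r := (ν A).toReal with hr
  have hm := h.measurable_pointCount hA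
  have h0 := h.measure_pointCount_eq_zero hA hν
  have h1 : P (pointCount κ Y A ⁻¹' {1}) = ENNReal.ofReal (Real.exp (-r) * r) := by
    have := h.poisson_law A hA hν 1
    rw [poissonMeasure_singleton] at this
    simp only [pow_one, Nat.factorial_one, Nat.cast_one, div_one] at this
    exact this
  have h2 : {ω | 2 ≤ pointCount κ Y A ω} =
      (pointCount κ Y A ⁻¹' {0} ∪ pointCount κ Y A ⁻¹' {1})ᶜ := by
    ext ω
    simp only [Set.mem_ofPred_eq, Set.mem_compl_iff, Set.mem_union, Set.mem_preimage,
      Set.mem_singleton_iff]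
    induction pointCount κ Y A ω using ENat.recTopCoe with
    | top => simp
    | coe n => norm_cast; omega
  have h3 : P (pointCount κ Y A ⁻¹' {0} ∪ pointCount κ Y A ⁻¹' {1}) =
      ENNReal.ofReal (Real.exp (-r) + Real.exp (-r) * r) := by
    rw [measure_union _ (hm (measurableSet_singleton _)), h0, h1,
      ← ENNReal.ofReal_add (by positivity) (by positivity)]
    exact Disjoint.preimage _ (by simp)
  rw [h2, prob_compl_eq_one_sub ((hm (measurableSet_singleton _)).union
    (hm (measurableSet_singleton _))), h3, ← ENNReal.ofReal_one,
    ← ENNReal.ofReal_sub _ (by positivity)]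
  refine ENNReal.ofReal_le_ofReal ?_
  -- From exp(-r) ≥ 1 - r one gets 1 - (1 + r)exp(-r) ≤ 1 - (1 + r)(1 - r) = r².
  have h4 := Real.add_one_le_exp (-r)
  have h5 : 0 ≤ r := ENNReal.toReal_nonneg
  nlinarith

lemma lintegral_inv_pow_pointCount_le (h : IsPoissonPointProcess κ Y ν P) {A : Set E}
    (hA : MeasurableSet A) (hν0 : ν A ≠ 0) (hν : ν A ≠ ∞) :
    ∫⁻ ω, ENNReal.ofReal ((ν A).toReal⁻¹ ^ (pointCount κ Y A ω).toNat) ∂P ≤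
      ENNReal.ofReal (Real.exp 1) := by
  rw [h.lintegral_comp_pointCount hA hν (fun n => ENNReal.ofReal ((ν A).toReal⁻¹ ^ n.toNat))]
  exact tsum_poisson_inv_pow_mul _ (ENNReal.toNNReal_pos hν0 hν)

lemma ae_pointCount_ne_top (h : IsPoissonPointProcess κ Y ν P) {A : Set E}
    (hA : MeasurableSet A) (hν : ν A ≠ ∞) : ∀ᵐ ω ∂P, pointCount κ Y A ω ≠ ⊤ := by
  have h1 : ∫⁻ ω, (pointCount κ Y A ω : ℝ≥0∞) ∂P ≠ ∞ := by rwa [h.lintegral_pointCount hA]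
  have hm : Measurable fun ω => (pointCount κ Y A ω : ℝ≥0∞) :=
    (Measurable.of_discrete (f := ENat.toENNReal)).comp (h.measurable_pointCount hA)
  filter_upwards [ae_lt_top hm h1] with ω hω htop
  simp [htop] at hω

variable {ι : Type*} [Fintype ι]

/-- Chernoff bound for the event that all cells `Q i`, `i ∈ s`, are occupied, written as a
half-space. -/
lemma measure_log_le_absSum (h : IsPoissonPointProcess κ Y ν P) (Q : ι → Set E)
    (hQ : ∀ i, MeasurableSet (Q i)) (hd : Pairwise fun i j => Disjoint (Q i) (Q j))
    (hν0 : ∀ i, ν (Q i) ≠ 0) (hν : ∀ i, ν (Q i) < 1) (s : Finset ι) :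
    P {ω | ENNReal.ofReal (∑ i ∈ s, Real.log (ν (Q i)).toReal⁻¹) ≤
        absSum κ Y (fun x => ∑ i ∈ s, Real.log (ν (Q i)).toReal⁻¹ * (Q i).indicator 1 x) ω} ≤
      ENNReal.ofReal (∏ i ∈ s, (Real.exp 1 * (ν (Q i)).toReal)) := by
  set a : ι → ℝ := fun i => (ν (Q i)).toReal with ha
  have hνt : ∀ i, ν (Q i) ≠ ∞ := fun i => ((hν i).trans ENNReal.one_lt_top).ne
  have ha0 : ∀ i, 0 < a i := fun i => ENNReal.toReal_pos (hν0 i) (hνt i)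
  have ha1 : ∀ i, a i < 1 := fun i => by
    have := (ENNReal.toReal_lt_toReal (hνt i) ENNReal.one_ne_top).2 (hν i)
    simpa using this
  have hc : ∀ i, 0 ≤ Real.log (a i)⁻¹ := fun i =>
    Real.log_nonneg ((one_le_inv₀ (ha0 i)).2 (ha1 i).le)
  -- Exponentiating the half-space inequality turns it into a lower bound on the product of the
  -- independent variables a^(-N), to which Markov's inequality applies.
  set X : ι → Ω → ℝ≥0∞ := fun i ω =>
    ENNReal.ofReal ((a i)⁻¹ ^ (pointCount κ Y (Q i) ω).toNat) with hX
  have hXm : ∀ i, Measurable (X i) := fun i =>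
    (Measurable.of_discrete (f := fun n : ℕ∞ => ENNReal.ofReal ((a i)⁻¹ ^ n.toNat))).comp
      (h.measurable_pointCount (hQ i))
  have hXi : iIndepFun X P := (h.iIndepFun_pointCount Q hQ hd).comp
    (fun i (n : ℕ∞) => ENNReal.ofReal ((a i)⁻¹ ^ n.toNat)) (fun i => .of_discrete)
  have hprod : ∫⁻ ω, ∏ i ∈ s, X i ω ∂P ≤ ENNReal.ofReal (Real.exp 1) ^ s.card := by
    rw [lintegral_prod_eq_prod_lintegral_of_indepFun s X hXi hXm, ← Finset.prod_const]
    exact Finset.prod_le_prod' fun i _ =>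
      h.lintegral_inv_pow_pointCount_le (hQ i) (hν0 i) (hνt i)
  have hinv : 0 < ∏ i ∈ s, (a i)⁻¹ := Finset.prod_pos fun i _ => inv_pos.2 (ha0 i)
  -- `toNat` sends infinity to 0, so the comparison is made only where all counts are finite.
  have hfin : ∀ᵐ ω ∂P, ∀ i, pointCount κ Y (Q i) ω ≠ ⊤ :=
    ae_all_iff.2 fun i => h.ae_pointCount_ne_top (hQ i) (hνt i)
  have hsub : P {ω | ENNReal.ofReal (∑ i ∈ s, Real.log (a i)⁻¹) ≤
        absSum κ Y (fun x => ∑ i ∈ s, Real.log (a i)⁻¹ * (Q i).indicator 1 x) ω} ≤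
      P {ω | ENNReal.ofReal (∏ i ∈ s, (a i)⁻¹) ≤ ∏ i ∈ s, X i ω} := by
    refine measure_mono_ae ?_
    filter_upwards [hfin] with ω hω hle
    have hle' : ENNReal.ofReal (∑ i ∈ s, Real.log (a i)⁻¹) ≤
        absSum κ Y (fun x => ∑ i ∈ s, Real.log (a i)⁻¹ * (Q i).indicator 1 x) ω := hle
    change ENNReal.ofReal (∏ i ∈ s, (a i)⁻¹) ≤ ∏ i ∈ s, X i ω
    rw [absSum_sum_indicator κ Y s _ (fun i _ => hc i)] at hle'
    have e1 : ∀ i, ENNReal.ofReal (Real.log (a i)⁻¹) * (pointCount κ Y (Q i) ω : ℝ≥0∞) =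
        ENNReal.ofReal (Real.log (a i)⁻¹ * (pointCount κ Y (Q i) ω).toNat) := by
      intro i
      rw [ENNReal.ofReal_mul (hc i), ENNReal.ofReal_natCast]
      conv_lhs => rw [← ENat.natCast_toNat (hω i)]
      simp
    simp_rw [e1] at hle'
    have hnn : ∀ i, 0 ≤ Real.log (a i)⁻¹ * ((pointCount κ Y (Q i) ω).toNat : ℝ) := fun i =>
      mul_nonneg (hc i) (Nat.cast_nonneg _)
    rw [← ENNReal.ofReal_sum_of_nonneg fun i _ => hnn i, ENNReal.ofReal_le_ofReal_iff
      (Finset.sum_nonneg fun i _ => hnn i)] at hle'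
    rw [hX, ← ENNReal.ofReal_prod_of_nonneg fun i _ => pow_nonneg (inv_nonneg.2 (ha0 i).le) _]
    refine ENNReal.ofReal_le_ofReal ?_
    have e2 := Real.exp_le_exp.2 hle'
    rw [Real.exp_sum, Real.exp_sum] at e2
    convert e2 using 1
    · refine Finset.prod_congr rfl fun i _ => ?_
      rw [Real.exp_log (inv_pos.2 (ha0 i))]
    · refine Finset.prod_congr rfl fun i _ => ?_
      rw [mul_comm, Real.exp_nat_mul, Real.exp_log (inv_pos.2 (ha0 i))]
  refine hsub.trans ((meas_ge_le_lintegral_div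
    (Finset.measurable_prod s fun i _ => hXm i).aemeasurable
    (ENNReal.ofReal_pos.2 hinv).ne' ENNReal.ofReal_ne_top).trans ?_)
  refine (ENNReal.div_le_div_right hprod _).trans (le_of_eq ?_)
  rw [← ENNReal.ofReal_pow (Real.exp_pos 1).le, ← ENNReal.ofReal_div_of_pos hinv,
    Finset.prod_mul_distrib, Finset.prod_const, Finset.prod_inv_distrib, div_inv_eq_mul]

lemma measure_occupied_eq [DecidableEq ι] (h : IsPoissonPointProcess κ Y ν P) (Q : ι → Set E)
    (hQ : ∀ i, MeasurableSet (Q i)) (hd : Pairwise fun i j => Disjoint (Q i) (Q j))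
    (hν : ∀ i, ν (Q i) ≠ ∞) (W : Finset ι) :
    P {ω | ∀ i, i ∈ W ↔ pointCount κ Y (Q i) ω ≠ 0} =
      ENNReal.ofReal (bernoulliWeight (fun i => 1 - Real.exp (-(ν (Q i)).toReal)) W) := by
  have h1 := (h.iIndepFun_pointCount Q hQ hd).measure_inter_preimage_eq_mul Finset.univ
    (sets := fun i => if i ∈ W then ({0}ᶜ : Set ℕ∞) else {0}) (fun i _ => .of_discrete)
  have h2 : {ω | ∀ i, i ∈ W ↔ pointCount κ Y (Q i) ω ≠ 0} = ⋂ i ∈ Finset.univ,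
      pointCount κ Y (Q i) ⁻¹' (if i ∈ W then ({0}ᶜ : Set ℕ∞) else {0}) := by
    ext ω
    simp only [Set.mem_ofPred_eq, Finset.mem_univ, Set.iInter_true, Set.mem_iInter]
    refine forall_congr' fun i => ?_
    by_cases hi : i ∈ W <;> simp [hi]
  rw [h2, h1, bernoulliWeight, ← Finset.prod_mul_prod_compl W]
  have e0 : ∀ i, Real.exp (-(ν (Q i)).toReal) ≤ 1 := fun i => Real.exp_le_one_iff.2 (by simp)
  rw [ENNReal.ofReal_mul (Finset.prod_nonneg fun i _ => sub_nonneg.2 (e0 i)),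
    ENNReal.ofReal_prod_of_nonneg fun i _ => sub_nonneg.2 (e0 i),
    ENNReal.ofReal_prod_of_nonneg fun i _ => by simp [Real.exp_nonneg]]
  congr 1
  · refine Finset.prod_congr rfl fun i hi => ?_
    rw [if_pos hi, Set.preimage_compl, prob_compl_eq_one_sub
      (h.measurable_pointCount (hQ i) (measurableSet_singleton _)),
      h.measure_pointCount_eq_zero (hQ i) (hν i), ← ENNReal.ofReal_one,
      ← ENNReal.ofReal_sub _ (Real.exp_nonneg _)]
  · refine Finset.prod_congr rfl fun i hi => ?_
    rw [if_neg (Finset.mem_compl.1 hi), h.measure_pointCount_eq_zero (hQ i) (hν i)]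
    simp

end IsPoissonPointProcess

end PoissonProcess

/-! ### Small cells for an atomless measure and step functions on them. -/

section Discretization

universe u v

/-- Every point is null, hence has an open neighbourhood of mass below `β`. Colour a point by the
first member of a countable subcover containing it; as `μ` is finite, all colours from some N on can
be merged at mass below `β`. -/
lemma exists_measurable_nat_small_fibers {E : Type*} [TopologicalSpace E]
    [SecondCountableTopology E] [MeasurableSpace E] [BorelSpace E] (μ : Measure E)
    [IsFiniteMeasure μ] [μ.OuterRegular] [NullSingletonClass μ] {β : ℝ≥0∞} (hβ : β ≠ 0) :
    ∃ c : E → ℕ, Measurable c ∧ (Set.range c).Finite ∧ ∀ j, μ (c ⁻¹' {j}) ≤ β := by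
  classical
  rcases isEmpty_or_nonempty E with hE | hE
  · exact ⟨fun _ => 0, measurable_const, Set.toFinite _, fun j => by
      simp [Set.eq_empty_of_isEmpty]⟩
  have h1 : ∀ x : E, ∃ U, x ∈ U ∧ IsOpen U ∧ μ U < β := by
    intro x
    obtain ⟨U, hxU, hU, hμ⟩ := Set.exists_isOpen_lt_of_lt (μ := μ) {x} β
      (by rw [measure_singleton]; exact pos_iff_ne_zero.2 hβ)
    exact ⟨U, hxU rfl, hU, hμ⟩
  choose U hxU hU hμU using h1
  obtain ⟨s, hs, hsU⟩ := TopologicalSpace.countable_cover_nhds fun x => (hU x).mem_nhds (hxU x)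
  have hne : s.Nonempty := by
    by_contra hcon
    rw [Set.not_nonempty_iff_eq_empty] at hcon
    simp [hcon] at hsU
    exact absurd hsU.symm Set.empty_ne_univ.symm
  obtain ⟨y, rfl⟩ := hs.exists_eq_range hne
  have hcov : ∀ x, ∃ n, x ∈ U (y n) := by
    intro x
    have : x ∈ ⋃ z ∈ Set.range y, U z := hsU ▸ Set.mem_univ x
    simpa using this
  set d : E → ℕ := fun x => Nat.find (hcov x) with hd
  have hdm : Measurable d := measurable_find hcov fun n => (hU (y n)).measurableSet
  have htail : Filter.Tendsto (fun n => μ {x | n ≤ d x}) Filter.atTop (nhds 0) := by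
    have := tendsto_measure_iInter_atTop (μ := μ) (s := fun n => {x | n ≤ d x})
      (fun n => (hdm (measurableSet_Ici (a := n))).nullMeasurableSet)
      (fun m n hmn x hx => le_trans hmn hx) ⟨0, measure_ne_top _ _⟩
    have he : ⋂ n, {x | n ≤ d x} = ∅ := by
      ext x
      simp only [Set.mem_iInter, Set.mem_ofPred_eq, Set.mem_empty_iff_false, iff_false, not_forall,
        not_le]
      exact ⟨d x + 1, Nat.lt_succ_self _⟩
    rwa [he, measure_empty] at this
  obtain ⟨N, hN⟩ := (htail.eventually_lt_const (pos_iff_ne_zero.2 hβ)).exists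
  refine ⟨fun x => min (d x) N, hdm.min measurable_const, ?_, fun j => ?_⟩
  · refine (Set.finite_Iic N).subset ?_
    rintro _ ⟨x, rfl⟩
    exact Set.mem_Iic.2 (min_le_right _ _)
  · rcases lt_or_ge j N with hj | hj
    · refine (measure_mono fun x hx => ?_).trans (hμU (y j)).le
      have hx' : min (d x) N = j := hx
      have : d x = j := by omega
      exact this ▸ Nat.find_spec (hcov x)
    · refine (measure_mono fun x hx => ?_).trans hN.le
      have hx' : min (d x) N = j := hx
      change N ≤ d x
      omega

lemma exists_nnreal_simpleFunc_le_lintegral_le_add {E : Type*} [MeasurableSpace E] {ν : Measure E}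
    {f : E → ℝ≥0∞} (hf : ∫⁻ x, f x ∂ν ≠ ∞) {ε : ℝ≥0∞} (hε : ε ≠ 0) :
    ∃ φ : SimpleFunc E ℝ≥0, (∀ x, (φ x : ℝ≥0∞) ≤ f x) ∧
      ∫⁻ x, f x ∂ν ≤ ∫⁻ x, φ x ∂ν + ε := by
  by_cases h0 : ∫⁻ x, f x ∂ν = 0
  · exact ⟨0, fun x => by simp, by simp [h0]⟩
  have h1 : ∫⁻ x, f x ∂ν - ε < ∫⁻ x, f x ∂ν := ENNReal.sub_lt_self hf h0 hε
  conv_rhs at h1 => rw [lintegral_eq_nnreal]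
  simp only [lt_iSup_iff] at h1
  obtain ⟨φ, hφ, h2⟩ := h1
  refine ⟨φ, hφ, ?_⟩
  rw [← SimpleFunc.lintegral_eq_lintegral] at h2
  exact tsub_le_iff_right.1 h2.le

/-- Finitely many integrable functions can be approximated from below by functions which are
constant on the cells of a finite family of small disjoint cells. -/
lemma exists_cells {τ : Type u} [Fintype τ] {E : Type v} [TopologicalSpace E]
    [TopologicalSpace.PseudoMetrizableSpace E]
    [SecondCountableTopology E] [MeasurableSpace E] [BorelSpace E] (ν : Measure E)
    [NullSingletonClass ν] (f : τ → E → ℝ≥0∞)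
    (hfi : ∀ t, ∫⁻ x, f t x ∂ν ≠ ∞) {ε : ℝ≥0∞} (hε : ε ≠ 0) {δ : ℝ≥0∞} (hδ : δ ≠ 0) :
    ∃ (ι : Type u) (_ : Fintype ι) (Q : ι → Set E) (lam : τ → ι → ℝ≥0),
      (∀ i, MeasurableSet (Q i)) ∧ Pairwise (fun i j => Disjoint (Q i) (Q j)) ∧
      (∀ i, ν (Q i) ≠ 0) ∧ (∀ i, ν (Q i) ≤ δ) ∧ ∑ i, ν (Q i) ^ 2 ≤ δ ∧
      ∀ t, (∀ x, ((∑ i, (Q i).indicator (fun _ => lam t i) x : ℝ≥0) : ℝ≥0∞) ≤ f t x) ∧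
        ∫⁻ x, (f t x - (∑ i, (Q i).indicator (fun _ => lam t i) x : ℝ≥0)) ∂ν ≤ ε := by
  classical
  choose φ hφle hφint using fun t =>
    exists_nnreal_simpleFunc_le_lintegral_le_add (hfi t) hε
  have hφtop : ∀ t, ∫⁻ x, φ t x ∂ν ≠ ∞ := fun t =>
    ne_top_of_le_ne_top (hfi t) (lintegral_mono (hφle t))
  set D : Set E := ⋃ t, Function.support (φ t) with hD
  have hDm : MeasurableSet D := MeasurableSet.iUnion fun t =>
    (measurableSet_support (φ t).measurable)
  have hDfin : ν D < ∞ := by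
    refine (measure_iUnion_le _).trans_lt ?_
    rw [tsum_fintype]
    refine ENNReal.sum_lt_top.2 fun t _ => ?_
    have h1 : ((φ t).map ((↑) : ℝ≥0 → ℝ≥0∞)).lintegral ν ≠ ∞ := by
      rw [← SimpleFunc.lintegral_eq_lintegral]; exact hφtop t
    have h2 := SimpleFunc.FinMeasSupp.of_lintegral_ne_top h1
    rw [SimpleFunc.finMeasSupp_iff_support] at h2
    refine lt_of_le_of_lt (measure_mono fun x hx => ?_) h2
    simpa using hx
  -- Cells inside `D` of mass at most `β` have mass at most `δ`, and their squared masses sum to at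
  -- most β·ν(D) ≤ δ.
  set β : ℝ≥0∞ := δ / (ν D + 1) with hβ
  have hD1 : ν D + 1 ≠ ∞ := by simp [hDfin.ne]
  have hβ0 : β ≠ 0 := by simp [hβ, ENNReal.div_eq_zero_iff, hδ, hDfin.ne]
  have hβδ : β ≤ δ := ENNReal.div_le_of_le_mul (le_mul_of_one_le_right' le_add_self)
  have hβD : β * ν D ≤ δ := by
    calc β * ν D ≤ β * (ν D + 1) := by gcongr; exact le_self_add
      _ = δ := ENNReal.div_mul_cancel (by simp) hD1
  have : IsFiniteMeasure (ν.restrict D) := ⟨by simpa using hDfin⟩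
  obtain ⟨c, hcm, hcfin, hc⟩ := exists_measurable_nat_small_fibers (ν.restrict D) hβ0
  -- The cells are level sets of the joint values of all the simple functions together with the
  -- colour.
  set s : E → (τ → ℝ≥0) × ℕ := fun x => (fun t => φ t x, c x) with hs
  have hsm : ∀ w, MeasurableSet (s ⁻¹' {w}) := by
    intro w
    have : s ⁻¹' {w} = (⋂ t, φ t ⁻¹' {w.1 t}) ∩ c ⁻¹' {w.2} := by
      ext x
      simp [hs, Prod.ext_iff, funext_iff]
    rw [this]
    exact (MeasurableSet.iInter fun t => (φ t).measurableSet_fiber _).inter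
      (hcm (measurableSet_singleton _))
  have hsfin : (Set.range s).Finite := by
    refine ((Set.Finite.pi' fun t => (φ t).finite_range).prod hcfin).subset ?_
    rintro _ ⟨x, rfl⟩
    exact ⟨fun t => ⟨x, rfl⟩, ⟨x, rfl⟩⟩
  -- Cells where every simple function vanishes are dropped, so that the rest lie in `D`; null cells
  -- are dropped because log(1/ν(Q)) is needed later.
  set I : Set ((τ → ℝ≥0) × ℕ) := {w | w ∈ Set.range s ∧ w.1 ≠ 0 ∧ ν (s ⁻¹' {w}) ≠ 0} with hI
  have hIfin : I.Finite := hsfin.subset fun w hw => hw.1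
  have := hIfin.fintype
  have hsubD : ∀ w : I, s ⁻¹' {w.1} ⊆ D := by
    intro w x hx
    have hx' : s x = w.1 := hx
    have h1 := w.2.2.1
    rw [← hx'] at h1
    obtain ⟨t, ht⟩ := Function.ne_iff.1 h1
    exact Set.mem_iUnion.2 ⟨t, ht⟩
  have hdisj : Pairwise fun i j : I => Disjoint (s ⁻¹' {i.1}) (s ⁻¹' {j.1}) := by
    intro i j hij
    refine Disjoint.preimage _ ?_
    simpa using fun h => hij (Subtype.ext h)
  have hsmall : ∀ w : I, ν (s ⁻¹' {w.1}) ≤ β := by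
    intro w
    refine le_trans ?_ (hc w.1.2)
    rw [Measure.restrict_apply (hcm (measurableSet_singleton _))]
    refine measure_mono fun x hx => ⟨?_, hsubD w hx⟩
    have hx' : s x = w.1 := hx
    change c x = w.1.2
    rw [← hx']
  have hval : ∀ t x, ∑ w : I, (s ⁻¹' {w.1}).indicator (fun _ => w.1.1 t) x =
      if s x ∈ I then φ t x else 0 := by
    intro t x
    split_ifs with h
    · rw [Finset.sum_eq_single_of_mem (⟨s x, h⟩ : I) (Finset.mem_univ _)]
      · simp [Set.indicator, hs]
      · intro w _ hw
        rw [Set.indicator_of_notMem]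
        intro hx
        exact hw (Subtype.ext (Eq.symm hx))
    · refine Finset.sum_eq_zero fun w _ => ?_
      rw [Set.indicator_of_notMem]
      intro hx
      have hx' : s x = w.1 := hx
      exact h (hx' ▸ w.2)
  have hae : ∀ᵐ x ∂ν, s x ∈ I ∨ ∀ t, φ t x = 0 := by
    have h1 : ν (⋃ w ∈ {w | w ∈ Set.range s ∧ ν (s ⁻¹' {w}) = 0}, s ⁻¹' {w}) = 0 := by
      rw [measure_biUnion_null_iff (hsfin.subset fun w hw => hw.1).countable]
      exact fun w hw => hw.2
    refine measure_mono_null (fun x hx => ?_) h1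
    have hx' : ¬ (s x ∈ I ∨ ∀ t, φ t x = 0) := hx
    push Not at hx'
    obtain ⟨hxI, t, ht⟩ := hx'
    refine Set.mem_biUnion (x := s x) ⟨⟨x, rfl⟩, ?_⟩ rfl
    by_contra hcon
    exact hxI ⟨⟨x, rfl⟩, fun h0 => ht (congrFun h0 t), hcon⟩
  refine ⟨I, inferInstance, fun w => s ⁻¹' {w.1}, fun t w => w.1.1 t, fun w => hsm _, hdisj,
    fun w => w.2.2.2, fun w => (hsmall w).trans hβδ, ?_, fun t => ⟨fun x => ?_, ?_⟩⟩
  · calc ∑ w : I, ν (s ⁻¹' {w.1}) ^ 2 ≤ ∑ w : I, β * ν (s ⁻¹' {w.1}) := by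
          refine Finset.sum_le_sum fun w _ => ?_
          rw [sq]
          gcongr
          exact hsmall w
      _ = β * ν (⋃ w : I, s ⁻¹' {w.1}) := by
          rw [← Finset.mul_sum, measure_iUnion hdisj fun w => hsm _, tsum_fintype]
      _ ≤ β * ν D := by gcongr; exact Set.iUnion_subset hsubD
      _ ≤ δ := hβD
  · rw [hval]
    split_ifs
    · exact hφle t x
    · simp
  · have h1 : ∫⁻ x, (f t x - (∑ w : I, (s ⁻¹' {w.1}).indicator (fun _ => w.1.1 t) x : ℝ≥0)) ∂ν =
        ∫⁻ x, (f t x - φ t x) ∂ν := by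
      refine lintegral_congr_ae ?_
      filter_upwards [hae] with x hx
      rw [hval]
      rcases hx with hx | hx
      · rw [if_pos hx]
      · rw [hx t, ite_self]
    rw [h1, lintegral_sub (φ t).measurable.coe_nnreal_ennreal (hφtop t)
      (Filter.Eventually.of_forall (hφle t))]
    exact tsub_le_iff_left.2 (hφint t)

end Discretization

/-! ### Half-space covers for the supremum. -/

section Cover

universe u v

/-- Half-spaces `{|X|_g ≥ u}` with small total probability cover the event `S`. -/
def HasHalfSpaceCover {Ω E : Type*} [MeasurableSpace Ω] [MeasurableSpace E] (κ : Ω → ℕ∞)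
    (Y : ℕ → Ω → E) (P : Measure Ω) (S : Set Ω) : Prop :=
  ∃ F : Set ((E → ℝ) × ℝ), F.Countable ∧
    (∀ p ∈ F, Measurable p.1 ∧ (∀ x, 0 ≤ p.1 x) ∧ 0 ≤ p.2) ∧
    S ⊆ ⋃ p ∈ F, {ω | ENNReal.ofReal p.2 ≤ absSum κ Y p.1 ω} ∧
    ∑' p : F, P {ω | ENNReal.ofReal p.1.2 ≤ absSum κ Y p.1.1 ω} ≤ 1 / 2

lemma HasHalfSpaceCover.of_fintype {Ω E J : Type*} [MeasurableSpace Ω] [MeasurableSpace E]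
    [Fintype J] {κ : Ω → ℕ∞} {Y : ℕ → Ω → E} {P : Measure Ω} {S : Set Ω} (g : J → E → ℝ)
    (u : J → ℝ) (hg : ∀ j, Measurable (g j)) (hg0 : ∀ j x, 0 ≤ g j x) (hu : ∀ j, 0 ≤ u j)
    (hS : ∀ ω ∈ S, ∃ j, ENNReal.ofReal (u j) ≤ absSum κ Y (g j) ω)
    (hP : ∑ j, P {ω | ENNReal.ofReal (u j) ≤ absSum κ Y (g j) ω} ≤ 1 / 2) :
    HasHalfSpaceCover κ Y P S := by
  refine ⟨Set.range fun j => (g j, u j), Set.countable_range _, ?_, ?_, ?_⟩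
  · rintro _ ⟨j, rfl⟩
    exact ⟨hg j, hg0 j, hu j⟩
  · intro ω hω
    obtain ⟨j, hj⟩ := hS ω hω
    exact Set.mem_biUnion (x := (g j, u j)) ⟨j, rfl⟩ hj
  · refine le_trans ?_ hP
    rw [← tsum_fintype (L := .unconditional _)]
    -- Different indices may give the same pair, so the sum over the range can only be smaller.
    exact ENNReal.tsum_le_tsum_comp_of_surjective
      (Set.rangeFactorization_surjective (f := fun j => (g j, u j)))
      (fun p : Set.range fun j => (g j, u j) =>
        P {ω | ENNReal.ofReal p.1.2 ≤ absSum κ Y p.1.1 ω})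

/-- If the truncated sum converged, only finitely many terms could reach 1, and restoring these
finite terms would keep the sum finite. -/
lemma tsum_min_one_eq_top {α : Type*} {f : α → ℝ≥0∞} (hf : ∀ i, f i ≠ ∞)
    (h : ∑' i, f i = ∞) : ∑' i, min (f i) 1 = ∞ := by
  classical
  by_contra hcon
  have hfin := ENNReal.finite_const_le_of_tsum_ne_top hcon one_ne_zero
  refine ENNReal.add_ne_top.2 ⟨ENNReal.sum_ne_top.2 fun i (_ : i ∈ hfin.toFinset) => hf i, hcon⟩
    (top_le_iff.1 ?_)
  rw [← h, sum_eq_tsum_indicator, ← ENNReal.tsum_add]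
  refine ENNReal.tsum_le_tsum fun i => ?_
  by_cases hi : i ∈ {i | 1 ≤ min (f i) 1}
  · rw [Set.indicator_of_mem (by simpa using hi)]
    exact le_self_add
  · have h1 : ¬ 1 ≤ min (f i) 1 := hi
    have h2 : f i < 1 := by
      by_contra h3
      exact h1 (le_min (not_lt.1 h3) le_rfl)
    rw [min_eq_left h2.le]
    exact le_add_self

lemma lintegral_abs_le_lintegral_supProcess {T : Type u} {Ω : Type v} [MeasurableSpace Ω]
    {P : Measure Ω} [IsProbabilityMeasure P] {ν : Measure (T → ℝ)} {κ : Ω → ℕ∞}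
    {Y : ℕ → Ω → (T → ℝ)} (h : IsPoissonPointProcess κ Y ν P) (t : T) :
    ∫⁻ x, ENNReal.ofReal |x t| ∂ν ≤ ∫⁻ ω, supProcess κ Y ω ∂P := by
  rw [← h.lintegral_absSum (f := fun x => x t) (measurable_pi_apply t)]
  exact lintegral_mono fun ω => le_iSup (fun t => absSum κ Y (fun x => x t) ω) t

variable {T : Type u} [Fintype T] {Ω : Type v} [MeasurableSpace Ω] {P : Measure Ω}
  [IsProbabilityMeasure P] {ν : Measure (T → ℝ)} {κ : Ω → ℕ∞} {Y : ℕ → Ω → (T → ℝ)}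

/-- This settles the case of infinite mean. A divergent sum stays divergent after truncation at 1,
while the truncated sum has finite mean by Campbell's formula, so Markov's inequality applies at a
high enough level. -/
lemma hasHalfSpaceCover_supProcess_eq_top [Nonempty T]
    (h : IsPoissonPointProcess κ Y ν P)
    (hν : ∀ t : T, ∫⁻ x, ENNReal.ofReal (min |x t| 1) ∂ν < ∞) :
    HasHalfSpaceCover κ Y P {ω | supProcess κ Y ω = ∞} := by
  set g : T → (T → ℝ) → ℝ := fun t x => min |x t| 1 with hg
  have hg0 : ∀ t x, 0 ≤ g t x := fun t x => le_min (abs_nonneg _) zero_le_one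
  have hgm : ∀ t, Measurable (g t) := fun t =>
    (measurable_norm.comp (measurable_pi_apply t)).min measurable_const
  have hI : ∀ t, ∫⁻ x, ENNReal.ofReal |g t x| ∂ν < ∞ := fun t => by
    simp_rw [abs_of_nonneg (hg0 t _)]
    exact hν t
  set n : ℝ := (Fintype.card T : ℝ) with hn
  have hn0 : 0 < n := by simp [hn, Fintype.card_pos]
  -- Markov's inequality gives at most 1/(2n) for each of the n coordinates; the summand 1 keeps the
  -- level positive.
  set u : T → ℝ := fun t => 2 * n * ((∫⁻ x, ENNReal.ofReal |g t x| ∂ν).toReal + 1) with hu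
  have hu0 : ∀ t, 0 < u t := fun t => by positivity
  refine HasHalfSpaceCover.of_fintype g u hgm hg0 (fun t => (hu0 t).le) (fun ω hω => ?_) ?_
  · have hω' : (⨆ t : T, absSum κ Y (fun x => x t) ω) = ∞ := hω
    obtain ⟨t, ht⟩ := exists_eq_ciSup_of_finite (f := fun t => absSum κ Y (fun x => x t) ω)
    refine ⟨t, ?_⟩
    have h1 : absSum κ Y (fun x => x t) ω = ∞ := ht.trans hω'
    have h2 := tsum_min_one_eq_top (fun _ => ENNReal.ofReal_ne_top) h1
    have h3 : absSum κ Y (g t) ω = ∞ := by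
      rw [← h2, absSum]
      refine tsum_congr fun i => ?_
      rw [abs_of_nonneg (hg0 t _), hg, ← ENNReal.ofReal_one, ← ENNReal.ofReal_min]
    rw [h3]
    exact le_top
  · have h1 : ∀ t, P {ω | ENNReal.ofReal (u t) ≤ absSum κ Y (g t) ω} ≤
        ENNReal.ofReal (1 / (2 * n)) := by
      intro t
      refine (h.measure_le_absSum (hgm t) (hu0 t)).trans ?_
      rw [← ENNReal.ofReal_toReal (hI t).ne, ← ENNReal.ofReal_div_of_pos (hu0 t)]
      refine ENNReal.ofReal_le_ofReal ?_
      have : 0 ≤ (∫⁻ x, ENNReal.ofReal |g t x| ∂ν).toReal := ENNReal.toReal_nonneg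
      rw [div_le_div_iff₀ (hu0 t) (by positivity)]
      simp only [hu]
      nlinarith
    refine (Finset.sum_le_sum fun t _ => h1 t).trans (le_of_eq ?_)
    rw [Finset.sum_const, nsmul_eq_mul, Finset.card_univ, ← ENNReal.ofReal_natCast,
      ← ENNReal.ofReal_mul (by positivity)]
    rw [show (Fintype.card T : ℝ) * (1 / (2 * n)) = 1 / 2 by rw [← hn]; field_simp]
    rw [ENNReal.ofReal_div_of_pos (by norm_num)]
    simp

/-- By Campbell's formula a zero mean makes every coordinate vanish ν-almost everywhere, so `ν`
would live on the origin, which is null. -/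
lemma lintegral_supProcess_ne_zero [NullSingletonClass ν] (hν0 : ν ≠ 0)
    (h : IsPoissonPointProcess κ Y ν P) : ∫⁻ ω, supProcess κ Y ω ∂P ≠ 0 := by
  intro h0
  have h1 : ∀ t, ∀ᵐ x ∂ν, ENNReal.ofReal |x t| = 0 := by
    intro t
    have h2 : ∫⁻ x, ENNReal.ofReal |x t| ∂ν = 0 :=
      le_antisymm (h0 ▸ lintegral_abs_le_lintegral_supProcess h t) zero_le
    have hm : Measurable fun x : T → ℝ => ENNReal.ofReal |x t| :=
      (measurable_norm.comp (measurable_pi_apply t)).ennreal_ofReal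
    exact (lintegral_eq_zero_iff hm).1 h2
  apply hν0
  rw [← Measure.measure_univ_eq_zero]
  refine measure_mono_null ?_ (measure_union_null (ae_all_iff.2 h1) (measure_singleton (μ := ν) 0))
  intro x _
  by_cases hx : ∀ t, ENNReal.ofReal |x t| = 0
  · right
    ext t
    simpa using hx t
  · exact Or.inl hx

/-- Each occupied cell holds at least one point, so the selector process evaluated at the set of
occupied cells lies below `supProcess`; that set has the product Bernoulli law. -/
lemma sum_bernoulliWeight_le_lintegral_supProcess [Nonempty T] {ι : Type*} [Fintype ι]
    [DecidableEq ι] (h : IsPoissonPointProcess κ Y ν P) (Q : ι → Set (T → ℝ))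
    (hQ : ∀ i, MeasurableSet (Q i)) (hd : Pairwise fun i j => Disjoint (Q i) (Q j))
    (hν : ∀ i, ν (Q i) ≠ ∞) (lam : T → ι → ℝ) (hlam0 : ∀ t i, 0 ≤ lam t i)
    (hlam : ∀ t x, ∑ i, lam t i * (Q i).indicator 1 x ≤ |x t|) :
    ENNReal.ofReal (∑ W, bernoulliWeight (fun i => 1 - Real.exp (-(ν (Q i)).toReal)) W *
      (⨆ t, ∑ i ∈ W, lam t i)) ≤ ∫⁻ ω, supProcess κ Y ω ∂P := by
  classical
  set p : ι → ℝ := fun i => 1 - Real.exp (-(ν (Q i)).toReal) with hp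
  have hp0 : ∀ i, 0 ≤ p i := fun i => by
    have : Real.exp (-(ν (Q i)).toReal) ≤ 1 := Real.exp_le_one_iff.2 (by simp)
    simp only [hp]; linarith
  have hp1 : ∀ i, p i ≤ 1 := fun i => by
    have := Real.exp_nonneg (-(ν (Q i)).toReal)
    simp only [hp]; linarith
  set M : Finset ι → ℝ := fun W => ⨆ t, ∑ i ∈ W, lam t i with hM
  have hM0 : ∀ W, 0 ≤ M W := fun W => Real.iSup_nonneg fun t =>
    Finset.sum_nonneg fun i _ => hlam0 t i
  set occ : Finset ι → Set Ω := fun W => {ω | ∀ i, i ∈ W ↔ pointCount κ Y (Q i) ω ≠ 0} with hocc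
  have hoccm : ∀ W, MeasurableSet (occ W) := by
    intro W
    have : occ W = ⋂ i, pointCount κ Y (Q i) ⁻¹' {n | i ∈ W ↔ n ≠ 0} := by
      ext ω; simp [hocc]
    rw [this]
    exact MeasurableSet.iInter fun i => h.measurable_pointCount (hQ i) .of_discrete
  have hpt : ∀ ω, ∑ W, (occ W).indicator (fun _ => ENNReal.ofReal (M W)) ω ≤
      supProcess κ Y ω := by
    intro ω
    set W₀ : Finset ι := {i | pointCount κ Y (Q i) ω ≠ 0} with hW₀
    have h1 : ∀ W, ω ∈ occ W ↔ W = W₀ := by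
      intro W
      simp only [hocc, hW₀, Set.mem_ofPred_eq, Finset.ext_iff, Finset.mem_filter, Finset.mem_univ,
        true_and]
    rw [Finset.sum_eq_single W₀ (fun W _ hW => Set.indicator_of_notMem (fun hω => hW ((h1 W).1 hω)) _)
      (by simp), Set.indicator_of_mem ((h1 W₀).2 rfl)]
    obtain ⟨t, ht⟩ := exists_eq_ciSup_of_finite (f := fun t => ∑ i ∈ W₀, lam t i)
    have hMt : M W₀ = ∑ i ∈ W₀, lam t i := ht.symm
    calc ENNReal.ofReal (M W₀) = ∑ i ∈ W₀, ENNReal.ofReal (lam t i) := by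
          rw [hMt, ENNReal.ofReal_sum_of_nonneg fun i _ => hlam0 t i]
      _ ≤ ∑ i ∈ W₀, ENNReal.ofReal (lam t i) * (pointCount κ Y (Q i) ω : ℝ≥0∞) := by
          refine Finset.sum_le_sum fun i hi => le_mul_of_one_le_right' ?_
          have : pointCount κ Y (Q i) ω ≠ 0 := (Finset.mem_filter.1 hi).2
          have h2 : (1 : ℕ∞) ≤ pointCount κ Y (Q i) ω := Order.one_le_iff_ne_zero.2 this
          exact_mod_cast h2
      _ ≤ ∑ i, ENNReal.ofReal (lam t i) * (pointCount κ Y (Q i) ω : ℝ≥0∞) :=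
          Finset.sum_le_univ_sum_of_nonneg fun i => zero_le
      _ = absSum κ Y (fun x => ∑ i, lam t i * (Q i).indicator 1 x) ω :=
          (absSum_sum_indicator κ Y Finset.univ _ (fun i _ => hlam0 t i) Q ω).symm
      _ ≤ absSum κ Y (fun x => x t) ω := absSum_mono κ Y (fun x => by
          have hnn : 0 ≤ ∑ i, lam t i * (Q i).indicator 1 x := Finset.sum_nonneg fun i _ =>
            mul_nonneg (hlam0 t i) (Set.indicator_nonneg (fun _ _ => zero_le_one) x)
          rw [abs_of_nonneg hnn]
          exact hlam t x) ω
      _ ≤ supProcess κ Y ω := le_iSup (fun t => absSum κ Y (fun x => x t) ω) t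
  calc ENNReal.ofReal (∑ W, bernoulliWeight p W * M W)
      = ∑ W, ENNReal.ofReal (M W) * P (occ W) := by
        rw [ENNReal.ofReal_sum_of_nonneg fun W _ =>
          mul_nonneg (bernoulliWeight_nonneg hp0 hp1 W) (hM0 W)]
        refine Finset.sum_congr rfl fun W _ => ?_
        rw [h.measure_occupied_eq Q hQ hd hν W, mul_comm, ENNReal.ofReal_mul (hM0 W)]
    _ = ∫⁻ ω, ∑ W, (occ W).indicator (fun _ => ENNReal.ofReal (M W)) ω ∂P := by
        rw [lintegral_finsetSum _ fun W _ => measurable_const.indicator (hoccm W)]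
        exact Finset.sum_congr rfl fun W _ => (lintegral_indicator_const (hoccm W) _).symm
    _ ≤ ∫⁻ ω, supProcess κ Y ω ∂P := lintegral_mono hpt

/-- For a in [0, 1], exp(-a) ≤ 1/(1 + a) ≤ 1 - a/2. It lets the intensity of a cell be replaced by
its occupation probability. -/
lemma half_le_one_sub_exp_neg {a : ℝ} (h0 : 0 ≤ a) (h1 : a ≤ 1) :
    a ≤ 2 * (1 - Real.exp (-a)) := by
  have h2 := Real.add_one_le_exp a
  have h3 : Real.exp (-a) ≤ 1 / (a + 1) := by
    rw [Real.exp_neg, inv_eq_one_div]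
    exact one_div_le_one_div_of_le (by linarith) h2
  have h4 : 1 / (a + 1) ≤ 1 - a / 2 := by
    rw [div_le_iff₀ (by linarith)]
    nlinarith
  linarith

lemma hasHalfSpaceCover_supProcess_ge [Nonempty T] [NullSingletonClass ν]
    (h : IsPoissonPointProcess κ Y ν P) (h0 : ∫⁻ ω, supProcess κ Y ω ∂P ≠ 0)
    (htop : ∫⁻ ω, supProcess κ Y ω ∂P ≠ ∞) {K : ℝ≥0}
    (hK : 4 * (1600 * (2 * Real.exp 1)) + 1 ≤ (K : ℝ)) :
    HasHalfSpaceCover κ Y P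
      {ω | (K : ℝ≥0∞) * ∫⁻ ω', supProcess κ Y ω' ∂P ≤ supProcess κ Y ω} := by
  classical
  set E := ∫⁻ ω, supProcess κ Y ω ∂P with hE
  set e := E.toReal with he
  have he0 : 0 < e := ENNReal.toReal_pos h0 htop
  have hEe : E = ENNReal.ofReal e := (ENNReal.ofReal_toReal htop).symm
  set n : ℝ := (Fintype.card T : ℝ) with hn
  have hn0 : 0 < n := by simp [hn, Fintype.card_pos]
  -- The error e/(8n) makes n Markov bounds at level e add up to 1/8. The value δ = 1/10000 ensures
  -- 1600·2·exp(1)·p ≤ 1 and makes double points rare.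
  obtain ⟨ι, _, Q, lam, hQ, hd, hQ0, hQδ, hQ2, hlam⟩ := exists_cells ν
    (fun (t : T) (x : T → ℝ) => ENNReal.ofReal |x t|)
    (fun t => ne_top_of_le_ne_top htop (lintegral_abs_le_lintegral_supProcess h t))
    (ε := ENNReal.ofReal (e / (8 * n))) (ENNReal.ofReal_pos.2 (by positivity)).ne'
    (δ := ENNReal.ofReal (1 / 10000)) (ENNReal.ofReal_pos.2 (by norm_num)).ne'
  have hQtop : ∀ i, ν (Q i) ≠ ∞ := fun i => ne_top_of_le_ne_top ENNReal.ofReal_ne_top (hQδ i)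
  set a : ι → ℝ := fun i => (ν (Q i)).toReal with ha
  have ha0 : ∀ i, 0 < a i := fun i => ENNReal.toReal_pos (hQ0 i) (hQtop i)
  have haδ : ∀ i, a i ≤ 1 / 10000 := fun i =>
    ENNReal.toReal_le_of_le_ofReal (by norm_num) (hQδ i)
  have hνa : ∀ i, ν (Q i) = ENNReal.ofReal (a i) := fun i => (ENNReal.ofReal_toReal (hQtop i)).symm
  set p : ι → ℝ := fun i => 1 - Real.exp (-a i) with hp
  have hap : ∀ i, a i ≤ 2 * p i := fun i =>
    half_le_one_sub_exp_neg (ha0 i).le ((haδ i).trans (by norm_num))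
  have hp0 : ∀ i, 0 < p i := fun i => by linarith [ha0 i, hap i]
  have hpa : ∀ i, p i ≤ a i := fun i => by
    have := Real.add_one_le_exp (-a i)
    simp only [hp]; linarith
  have hexp : Real.exp 1 < 3 := by linarith [Real.exp_one_lt_d9]
  have hexp1 : 1 ≤ Real.exp 1 := Real.one_le_exp zero_le_one
  set step : T → (T → ℝ) → ℝ := fun t x => ∑ i, (lam t i : ℝ) * (Q i).indicator 1 x with hstep
  have hstep_eq : ∀ t x, step t x =
      ((∑ i, (Q i).indicator (fun _ => lam t i) x : ℝ≥0) : ℝ) := by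
    intro t x
    rw [NNReal.coe_sum]
    refine Finset.sum_congr rfl fun i _ => ?_
    by_cases hx : x ∈ Q i <;> simp [hx]
  have hstep0 : ∀ t x, 0 ≤ step t x := fun t x => by rw [hstep_eq]; exact NNReal.coe_nonneg _
  have hstep_le : ∀ t x, step t x ≤ |x t| := by
    intro t x
    have := (hlam t).1 x
    rw [← ENNReal.ofReal_coe_nnreal, ← hstep_eq] at this
    exact (ENNReal.ofReal_le_ofReal_iff (abs_nonneg _)).1 this
  set g : T → (T → ℝ) → ℝ := fun t x => |x t| - step t x with hg
  have hg0 : ∀ t x, 0 ≤ g t x := fun t x => sub_nonneg.2 (hstep_le t x)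
  have hind : ∀ i, Measurable fun x => (Q i).indicator (1 : (T → ℝ) → ℝ) x := fun i =>
    measurable_one.indicator (hQ i)
  have hgm : ∀ t, Measurable (g t) := fun t =>
    (measurable_norm.comp (measurable_pi_apply t)).sub
      (Finset.measurable_fun_sum _ fun i _ => (hind i).const_mul _)
  have hgint : ∀ t, ∫⁻ x, ENNReal.ofReal |g t x| ∂ν ≤ ENNReal.ofReal (e / (8 * n)) := by
    intro t
    refine le_trans (le_of_eq (lintegral_congr fun x => ?_)) (hlam t).2
    rw [abs_of_nonneg (hg0 t x), hg, ENNReal.ofReal_sub _ (hstep0 t x), hstep_eq,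
      ENNReal.ofReal_coe_nnreal]
  have hmean : ∑ W, bernoulliWeight p W * (⨆ t, ∑ i ∈ W, (lam t i : ℝ)) ≤ e := by
    have := sum_bernoulliWeight_le_lintegral_supProcess h Q hQ hd hQtop (fun t i => (lam t i : ℝ))
      (fun t i => NNReal.coe_nonneg _) hstep_le
    rw [← hE, hEe] at this
    exact (ENNReal.ofReal_le_ofReal_iff he0.le).1 this
  -- The choice c = 2·exp(1) matches the Chernoff factor exp(1)·a for each cell together with a ≤
  -- 2p.
  obtain ⟨G, hGcov, hGcost⟩ := exists_selector_cover (fun t i => (lam t i : ℝ))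
    (fun t i => NNReal.coe_nonneg _) p hp0 (c := 2 * Real.exp 1) (by linarith)
    (fun i => by nlinarith [hpa i, haδ i, hp0 i]) he0 hmean
  have hlog0 : ∀ i, 0 ≤ Real.log (a i)⁻¹ := fun i =>
    Real.log_nonneg ((one_le_inv₀ (ha0 i)).2 ((haδ i).trans (by norm_num)))
  -- Three families: large remainders (total at most 1/8), doubly occupied cells (at most 1/8), and
  -- fully occupied fragments (at most 1/4).
  refine HasHalfSpaceCover.of_fintype (J := T ⊕ ι ⊕ G)
    (Sum.elim g (Sum.elim (fun i => (Q i).indicator 1)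
      (fun s x => ∑ i ∈ s.1, Real.log (a i)⁻¹ * (Q i).indicator 1 x)))
    (Sum.elim (fun _ => e) (Sum.elim (fun _ => 2) (fun s => ∑ i ∈ s.1, Real.log (a i)⁻¹)))
    ?_ ?_ ?_ ?_ ?_
  · rintro (t | i | s)
    · exact hgm t
    · exact hind i
    · exact Finset.measurable_fun_sum _ fun i _ => (hind i).const_mul _
  · rintro (t | i | s) x
    · exact hg0 t x
    · exact Set.indicator_nonneg (fun _ _ => zero_le_one) x
    · exact Finset.sum_nonneg fun i _ => mul_nonneg (hlog0 i)
        (Set.indicator_nonneg (fun _ _ => zero_le_one) x)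
  · rintro (t | i | s)
    · exact he0.le
    · exact zero_le_two
    · exact Finset.sum_nonneg fun i _ => hlog0 i
  · intro ω hω
    by_contra! hcon
    have hω' : (K : ℝ≥0∞) * E ≤ ⨆ t : T, absSum κ Y (fun x => x t) ω := hω
    obtain ⟨t, ht⟩ := exists_eq_ciSup_of_finite (f := fun t => absSum κ Y (fun x => x t) ω)
    rw [← ht] at hω'
    have hgω : absSum κ Y (g t) ω < ENNReal.ofReal e := hcon (Sum.inl t)
    have hcount : ∀ i, pointCount κ Y (Q i) ω ≤ 1 := by
      intro i
      have h1 : absSum κ Y ((Q i).indicator 1) ω < ENNReal.ofReal 2 := hcon (Sum.inr (Sum.inl i))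
      rw [absSum_indicator] at h1
      have h2 : pointCount κ Y (Q i) ω < 2 := by
        rw [← ENat.toENNReal_lt]
        simpa using h1
      induction hN : pointCount κ Y (Q i) ω using ENat.recTopCoe with
      | top => simp [hN] at h2
      | coe m =>
        rw [hN] at h2
        norm_cast at h2 ⊢
        omega
    set W : Finset ι := {i | pointCount κ Y (Q i) ω ≠ 0} with hW
    have hsplit : absSum κ Y (fun x => x t) ω ≤
        ENNReal.ofReal e + ENNReal.ofReal (∑ i ∈ W, (lam t i : ℝ)) := by
      calc absSum κ Y (fun x => x t) ω ≤ absSum κ Y (fun x => g t x + step t x) ω :=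
            absSum_mono κ Y (fun x => by simp [hg]) ω
        _ = absSum κ Y (g t) ω + absSum κ Y (step t) ω := absSum_add κ Y (hg0 t) (hstep0 t) ω
        _ ≤ _ := by
            refine add_le_add hgω.le ?_
            rw [hstep, absSum_sum_indicator κ Y _ _ fun i _ => NNReal.coe_nonneg _,
              ENNReal.ofReal_sum_of_nonneg fun i _ => NNReal.coe_nonneg _, hW,
              Finset.sum_filter]
            refine Finset.sum_le_sum fun i _ => ?_
            split_ifs with hi
            · refine mul_le_of_le_one_right' ?_
              exact_mod_cast hcount i
            · simp [not_not.1 hi]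
    -- The summand 1 in the lower bound on `K` pays for the remainder, which is below e.
    have hbig : 4 * (1600 * (2 * Real.exp 1)) * e ≤ ∑ i ∈ W, (lam t i : ℝ) := by
      have h1 := hω'.trans hsplit
      have hs0 : 0 ≤ ∑ i ∈ W, (lam t i : ℝ) := Finset.sum_nonneg fun i _ => NNReal.coe_nonneg _
      rw [hEe, ← ENNReal.ofReal_coe_nnreal, ← ENNReal.ofReal_mul (NNReal.coe_nonneg _),
        ← ENNReal.ofReal_add he0.le hs0, ENNReal.ofReal_le_ofReal_iff (by linarith)] at h1
      nlinarith
    obtain ⟨s, hsG, hsW⟩ := hGcov W t hbig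
    have h1 : absSum κ Y (fun x => ∑ i ∈ s, Real.log (a i)⁻¹ * (Q i).indicator 1 x) ω <
      ENNReal.ofReal (∑ i ∈ s, Real.log (a i)⁻¹) := hcon (Sum.inr (Sum.inr ⟨s, hsG⟩))
    rw [absSum_sum_indicator κ Y s _ (fun i _ => hlog0 i),
      ENNReal.ofReal_sum_of_nonneg fun i _ => hlog0 i] at h1
    refine absurd h1 (not_lt.2 (Finset.sum_le_sum fun i hi => le_mul_of_one_le_right' ?_))
    have h2 : pointCount κ Y (Q i) ω ≠ 0 := (Finset.mem_filter.1 (hsW hi)).2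
    have h3 : (1 : ℕ∞) ≤ pointCount κ Y (Q i) ω := Order.one_le_iff_ne_zero.2 h2
    exact_mod_cast h3
  · rw [Fintype.sum_sum_type, Fintype.sum_sum_type]
    have hb1 : ∑ t, P {ω | ENNReal.ofReal e ≤ absSum κ Y (g t) ω} ≤ ENNReal.ofReal (1 / 8) := by
      have h1 : ∀ t, P {ω | ENNReal.ofReal e ≤ absSum κ Y (g t) ω} ≤
          ENNReal.ofReal (1 / (8 * n)) := by
        intro t
        refine (h.measure_le_absSum (hgm t) he0).trans
          ((ENNReal.div_le_div_right (hgint t) _).trans (le_of_eq ?_))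
        rw [← ENNReal.ofReal_div_of_pos he0]
        congr 1
        field_simp
      refine (Finset.sum_le_sum fun t _ => h1 t).trans (le_of_eq ?_)
      rw [Finset.sum_const, nsmul_eq_mul, Finset.card_univ, ← ENNReal.ofReal_natCast,
        ← ENNReal.ofReal_mul (by positivity)]
      congr 1
      rw [← hn]
      field_simp
    have hb2 : ∑ i, P {ω | ENNReal.ofReal 2 ≤ absSum κ Y ((Q i).indicator 1) ω} ≤
        ENNReal.ofReal (1 / 8) := by
      refine le_trans (Finset.sum_le_sum fun i _ => ?_)
        (hQ2.trans (ENNReal.ofReal_le_ofReal (by norm_num)))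
      have h1 : {ω | ENNReal.ofReal 2 ≤ absSum κ Y ((Q i).indicator 1) ω} =
          {ω | 2 ≤ pointCount κ Y (Q i) ω} := by
        ext ω
        simp only [Set.mem_ofPred_eq, absSum_indicator]
        rw [← ENat.toENNReal_le]
        simp
      rw [h1, hνa, ← ENNReal.ofReal_pow (ha0 i).le]
      exact h.measure_two_le_pointCount (hQ i) (hQtop i)
    have hb3 : ∑ s : G, P {ω | ENNReal.ofReal (∑ i ∈ s.1, Real.log (a i)⁻¹) ≤
        absSum κ Y (fun x => ∑ i ∈ s.1, Real.log (a i)⁻¹ * (Q i).indicator 1 x) ω} ≤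
        ENNReal.ofReal (1 / 4) := by
      have hcp0 : ∀ i, 0 ≤ 2 * Real.exp 1 * p i := fun i =>
        mul_nonneg (by linarith) (hp0 i).le
      have h1 : ∀ s : G, P {ω | ENNReal.ofReal (∑ i ∈ s.1, Real.log (a i)⁻¹) ≤
          absSum κ Y (fun x => ∑ i ∈ s.1, Real.log (a i)⁻¹ * (Q i).indicator 1 x) ω} ≤
          ENNReal.ofReal (∏ i ∈ s.1, (2 * Real.exp 1 * p i)) := by
        intro s
        refine (h.measure_log_le_absSum Q hQ hd hQ0 (fun i => ?_) s.1).trans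
          (ENNReal.ofReal_le_ofReal (Finset.prod_le_prod (fun i _ => ?_) fun i _ => ?_))
        · refine (hQδ i).trans_lt ?_
          rw [← ENNReal.ofReal_one]
          exact (ENNReal.ofReal_lt_ofReal_iff one_pos).2 (by norm_num)
        · exact mul_nonneg (by linarith) (ha0 i).le
        · change Real.exp 1 * a i ≤ _
          nlinarith [hap i]
      refine (Finset.sum_le_sum fun s _ => h1 s).trans ?_
      rw [← ENNReal.ofReal_sum_of_nonneg fun s _ => Finset.prod_nonneg fun i _ => hcp0 i,
        Finset.sum_coe_sort G fun s => ∏ i ∈ s, (2 * Real.exp 1 * p i)]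
      exact ENNReal.ofReal_le_ofReal hGcost
    refine (add_le_add hb1 (add_le_add hb2 hb3)).trans (le_of_eq ?_)
    rw [← ENNReal.ofReal_add (by norm_num) (by norm_num),
      ← ENNReal.ofReal_add (by norm_num) (by norm_num),
      show (1 / 8 + (1 / 8 + 1 / 4) : ℝ) = 1 / 2 by norm_num,
      ENNReal.ofReal_div_of_pos (by norm_num)]
    simp

end Cover
end

theorem mainTheorem2 :
    ∃ K : ℝ≥0, 0 < K ∧
      ∀ (T : Type*) [Fintype T] (ν : Measure (T → ℝ)) [SigmaFinite ν] [NullSingletonClass ν],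
        ν ≠ 0 →
        (∀ t : T, ∫⁻ x, ENNReal.ofReal (min |x t| 1) ∂ν < ∞) →
        ∀ (Ω : Type*) [MeasurableSpace Ω] (P : Measure Ω) [IsProbabilityMeasure P]
          (κ : Ω → ℕ∞) (Y : ℕ → Ω → (T → ℝ)),
          IsPoissonPointProcess κ Y ν P →
          ∃ F : Set (((T → ℝ) → ℝ) × ℝ),
            F.Countable ∧
            (∀ p ∈ F, Measurable p.1 ∧ (∀ x, 0 ≤ p.1 x) ∧ 0 ≤ p.2) ∧
            {ω | (K : ℝ≥0∞) * ∫⁻ ω', supProcess κ Y ω' ∂P ≤ supProcess κ Y ω} ⊆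
              ⋃ p ∈ F, {ω | ENNReal.ofReal p.2 ≤ absSum κ Y p.1 ω} ∧
            ∑' p : F, P {ω | ENNReal.ofReal p.1.2 ≤ absSum κ Y p.1.1 ω} ≤ 1 / 2 := by
  -- As exp(1) < 3, the required 4·1600·2·exp(1) + 1 is below 38401.
  refine ⟨40000, by norm_num, ?_⟩
  intro T _ ν _ _ hν0 hν Ω _ P _ κ Y h
  have h0 := lintegral_supProcess_ne_zero hν0 h
  -- Over an empty index set the supremum is 0, contradicting the nonzero mean.
  have hT : Nonempty T := by
    by_contra hT
    rw [not_nonempty_iff] at hT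
    exact h0 (by simp [supProcess])
  by_cases htop : ∫⁻ ω, supProcess κ Y ω ∂P = ∞
  · obtain ⟨F, hF, hFm, hFS, hFP⟩ := hasHalfSpaceCover_supProcess_eq_top h hν
    refine ⟨F, hF, hFm, fun ω hω => hFS ?_, hFP⟩
    have hω' : ((40000 : ℝ≥0) : ℝ≥0∞) * ∫⁻ ω', supProcess κ Y ω' ∂P ≤ supProcess κ Y ω := hω
    rw [htop, ENNReal.mul_top (by simp)] at hω'
    exact top_le_iff.1 hω'
  · exact hasHalfSpaceCover_supProcess_ge h h0 htop (by
      have : Real.exp 1 < 3 := by linarith [Real.exp_one_lt_d9]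
      norm_num
      linarith)
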